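/- **Theorem 5.8.** A $d$-dimensional state is a positive semidefinite matrix $\rho\in\mathbb C^{d\times d}$ with trace $1$; its spectrum is the multiset of its eigenvalues with multiplicity, and the rank of a spectrum is the number of its nonzero entries. A $D$-dimensional POVM is a finite family $\{F_s\}_s$ of positive semidefinite $D\times D$ matrices with $\sum_s F_s=\mathbb 1_D$; measuring a state $\sigma$ with it gives the outcome $s$ with probability $\operatorname{tr}(F_s\sigma)$. A $k$-replica protocol with $T$ rounds, given copies of an unknown $d$-dimensional state $\rho$, measures in each round $k$ fresh copies, i.e. $\rho^{\otimes k}$, jointly with a $d^k$-dimensional POVM that may depend on all earlier outcomes, and after the last round outputs an answer that depends on all $T$ outcomes and possibly on additional randomness. It uses $kT$ samples. For probability distributions $p=(p_1,\dots,p_d)$ and $q=(q_1,\dots,q_d)$, the protocol solves $p$-versus-$q$ spectrum testing if it answers "$p$" with probability at least $0.9$ on every state with spectrum $p$, and answers "$q$" with probability at least $0.9$ on every state with spectrum $q$. There is a universal constant $c>0$ such that the following holds for all integers $d,k,m\ge 1$ and $T\ge 0$. Let $p,q$ be probability distributions on $\{1,\dots,d\}$, each of rank at most $m$, with $$\sum_{r=1}^d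 p_r^i=\sum_{r=1}^d q_r^i\qquad\text{for all } i\in\{1,\dots,k\}.$$ Then every $k$-replica protocol with $T$ rounds that solves $p$-versus-$q$ spectrum testing satisfies $$kT\cdot m\sqrt{\ln m}\;\ge\; c\,\sqrt d .$$ That is, its sample complexity is $\Omega\!\left(\frac{\sqrt d}{m\sqrt{\ln m}}\right)$; for $m=1$ the inequality says that no such protocol exists. -/

import Mathlib

namespace ReplicaTesting

open scoped ComplexOrder

/-- `ρ` is a state (density matrix) of a `d`-dimensional system. -/
def IsState {d : ℕ} (ρ : Matrix (Fin d) (Fin d) ℂ) : Prop :=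
  ρ.PosSemidef ∧ ρ.trace = 1

/-- The spectrum of `ρ` is `p`: `ρ` is Hermitian and its eigenvalues, listed with multiplicity,
are the entries of `p` in some order. -/
def HasSpectrum {d : ℕ} (ρ : Matrix (Fin d) (Fin d) ℂ) (p : Fin d → ℝ) : Prop :=
  ∃ h : ρ.IsHermitian,
    Multiset.map h.eigenvalues Finset.univ.val = Multiset.map p Finset.univ.val

/-- The rank of a spectrum: the number of its nonzero entries. -/
noncomputable def spectrumRank {d : ℕ} (p : Fin d → ℝ) : ℕ :=
  (Function.support p).ncard

/-- `ρ^{⊗ k}`, a `d ^ k`-dimensional matrix whose rows and columns are indexed by `k`-tuples. -/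
def tensorPower {d : ℕ} (ρ : Matrix (Fin d) (Fin d) ℂ) (k : ℕ) :
    Matrix (Fin k → Fin d) (Fin k → Fin d) ℂ :=
  Matrix.of fun a b => ∏ i, ρ (a i) (b i)

/-- `F` is a POVM with outcomes in `S` on the space with basis `ι`. -/
def IsPOVM {S ι : Type} [Fintype S] [DecidableEq ι] (F : S → Matrix ι ι ℂ) : Prop :=
  (∀ s, (F s).PosSemidef) ∧ ∑ s, F s = 1

/-- A `k`-replica protocol with `T` rounds for deciding between two hypotheses about an unknown
`d`-dimensional state. In round `t` it measures `k` fresh copies of the state jointly, by a POVM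
that may depend on all the outcomes of the earlier rounds. After the last round it announces the
first or the second hypothesis, depending on all the outcomes and possibly on a coin. -/
structure ReplicaProtocol (S : Type) [Fintype S] (d k T : ℕ) where
  /-- `povm t h s` is the operator of outcome `s` in round `t`, after the outcomes `h`. -/
  povm : (t : Fin T) → (Fin t → S) → S → Matrix (Fin k → Fin d) (Fin k → Fin d) ℂ
  isPOVM : ∀ t h, IsPOVM (povm t h)
  /-- The probability of announcing the first hypothesis after the given outcomes. -/
  guess : (Fin T → S) → ℝ
  guess_mem : ∀ s, guess s ∈ Set.Icc (0 : ℝ) 1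

namespace ReplicaProtocol

variable {S : Type} [Fintype S] {d k T : ℕ}

/-- The probability that the outcomes of the `T` rounds are `s 0, …, s (T - 1)` when the
unknown state is `ρ`. -/
noncomputable def outcomeProb (P : ReplicaProtocol S d k T) (ρ : Matrix (Fin d) (Fin d) ℂ)
    (s : Fin T → S) : ℝ :=
  ∏ t : Fin T,
    (P.povm t (fun i => s (Fin.castLE t.isLt.le i)) (s t) * tensorPower ρ k).trace.re

/-- The probability of announcing the first hypothesis when the unknown state is `ρ`. -/
noncomputable def probFirst (P : ReplicaProtocol S d k T) (ρ : Matrix (Fin d) (Fin d) ℂ) : ℝ :=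
  ∑ s : Fin T → S, P.outcomeProb ρ s * P.guess s

/-- The probability of announcing the second hypothesis when the unknown state is `ρ`. -/
noncomputable def probSecond (P : ReplicaProtocol S d k T) (ρ : Matrix (Fin d) (Fin d) ℂ) : ℝ :=
  ∑ s : Fin T → S, P.outcomeProb ρ s * (1 - P.guess s)

/-- The protocol solves `p`-versus-`q` spectrum testing: for every state whose spectrum is `p`
it announces the first hypothesis, and for every state whose spectrum is `q` the second one,
with probability at least `0.9`. -/
def SolvesSpectrumTesting (P : ReplicaProtocol S d k T) (p q : Fin d → ℝ) : Prop :=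
  (∀ ρ, IsState ρ → HasSpectrum ρ p → 9 / 10 ≤ P.probFirst ρ) ∧
  (∀ ρ, IsState ρ → HasSpectrum ρ q → 9 / 10 ≤ P.probSecond ρ)

/-- The number of copies of the unknown state that the protocol consumes. -/
def samples (_P : ReplicaProtocol S d k T) : ℕ := k * T

end ReplicaProtocol

end ReplicaTesting

namespace ReplicaTesting

open scoped ComplexOrder ComplexConjugate BigOperators Nat
open MeasureTheory

/-! The unknown state is replaced by the random matrix `gaussianState p z`, a combination with
weights `p r` of the matrices `|g r⟩⟨g r| / d` for independent Gaussian vectors `g r`. By Wick's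
theorem its mean `k`-th tensor power is a sum over permutations whose coefficients are, up to
scaling, products of power sums of `p` with exponents at most `k`. Matching power sums therefore
give the same matrix `Ω` for `p` and `q` (`meanTensorPower_eq_of_powerSum_eq`). A fictitious
experiment that measures `Ω` afresh in every round cannot tell `p` from `q`, and its total outcome
weight is `(tr Ω) ^ T ≥ 1`.

The crux is a one-sided comparison with the experiment in which one random state persists through
all rounds. Each outcome weight of a round is a sum of squared moduli of holomorphic polynomials,
homogeneous of degree `k` in the Gaussian variables, and Bombieri's inequality
`gaussianNormSq_mul_le` bounds a product of Gaussian norms by the norm of the product. So each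
outcome string is at least as heavy under the persistent state, on average, as under `Ω`
(`prod_trace_meanTensorPower_le`). Adaptivity is harmless, because the comparison is made for one
fixed string at a time.

Finally, at most `m` Gaussian vectors in dimension `d` are nearly orthonormal: the mean squared
Frobenius error of their Gram matrix is at most `m ^ 2 / d`. Typically, then, `gaussianState p z ≤
(1 + ε) ρ` for a state `ρ` of spectrum `p` and `ε` of order `m / √d` (`exists_state_dominating`).
Over `n = k * T` copies the loss `(1 + ε) ^ n` is bounded if `n * m` is a small multiple of `√d`.
The answer that is wrong for `p` then has weight at most `2/5` under `Ω`, and so has the answer that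
is wrong for `q`, contradicting total weight at least `1`. This yields `√d ≤ 30 * (k * T) * m`,
without a logarithm; `√(ln m)` is inserted at the very end. -/

/-! ### Moments of complex Gaussian variables. -/

/-- The standard complex Gaussian measure, with density `exp (-|z|²) / π`. -/
noncomputable def complexGaussian : Measure ℂ :=
  volume.withDensity fun z => ENNReal.ofReal (Real.pi⁻¹ * Real.exp (-‖z‖ ^ 2))

lemma integral_complexGaussian {E : Type*} [NormedAddCommGroup E] [NormedSpace ℝ E] (f : ℂ → E) :
    ∫ z, f z ∂complexGaussian = ∫ z, (Real.pi⁻¹ * Real.exp (-‖z‖ ^ 2)) • f z := by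
  rw [complexGaussian, integral_withDensity_eq_integral_toReal_smul (by fun_prop) (by simp)]
  refine integral_congr_ae (.of_forall fun z => ?_)
  simp only
  rw [ENNReal.toReal_ofReal (by positivity)]

lemma integrable_complexGaussian_iff {E : Type*} [NormedAddCommGroup E] [NormedSpace ℝ E]
    (f : ℂ → E) :
    Integrable f complexGaussian ↔
      Integrable (fun z => (Real.pi⁻¹ * Real.exp (-‖z‖ ^ 2)) • f z) := by
  rw [complexGaussian, integrable_withDensity_iff_integrable_smul' (by fun_prop) (by simp)]
  refine integrable_congr (.of_forall fun z => ?_)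
  simp only
  rw [ENNReal.toReal_ofReal (by positivity)]

lemma integral_norm_pow_mul_exp (n : ℕ) {b : ℝ} (hb : 0 < b) :
    ∫ z : ℂ, ‖z‖ ^ (2 * n) * Real.exp (-b * ‖z‖ ^ 2) = Real.pi * (n ! / b ^ (n + 1)) := by
  have h := Complex.integral_rpow_mul_exp_neg_mul_rpow (p := 2) (q := (2 * n : ℕ)) (b := b)
    (by norm_num) (by linarith [Nat.cast_nonneg (α := ℝ) (2 * n)]) hb
  have e1 : ((2 * n : ℕ) + 2 : ℝ) / 2 = n + 1 := by push_cast; ring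
  have e2 : -((2 * n : ℕ) + 2 : ℝ) / 2 = -((n + 1 : ℕ) : ℝ) := by push_cast; ring
  rw [e1, e2, Real.Gamma_nat_eq_factorial, Real.rpow_neg hb.le, Real.rpow_natCast] at h
  simp only [Real.rpow_natCast, Real.rpow_two] at h
  rw [h]
  field_simp

lemma integrable_norm_pow_mul_exp (n : ℕ) {b : ℝ} (hb : 0 < b) :
    Integrable fun z : ℂ => ‖z‖ ^ (2 * n) * Real.exp (-b * ‖z‖ ^ 2) := by
  -- The integral of a non-integrable function is `0` by convention, so a nonzero value proves
  -- integrability.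
  refine not_imp_comm.1 integral_undef ?_
  rw [integral_norm_pow_mul_exp n hb]
  positivity

lemma integral_norm_pow_complexGaussian (n : ℕ) :
    ∫ z, ‖z‖ ^ (2 * n) ∂complexGaussian = n ! := by
  rw [integral_complexGaussian]
  have h := integral_norm_pow_mul_exp n one_pos
  calc _ = ∫ z : ℂ, Real.pi⁻¹ * (‖z‖ ^ (2 * n) * Real.exp (-1 * ‖z‖ ^ 2)) := by
        congr 1; ext z; simp only [smul_eq_mul, neg_mul, one_mul]; ring
    _ = _ := by
        rw [integral_const_mul, h]; field_simp; simp

lemma integrable_norm_pow_complexGaussian (n : ℕ) :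
    Integrable (fun z => ‖z‖ ^ (2 * n)) complexGaussian := by
  rw [integrable_complexGaussian_iff]
  refine ((integrable_norm_pow_mul_exp n one_pos).const_mul Real.pi⁻¹).congr (.of_forall fun z => ?_)
  simp only [smul_eq_mul, neg_mul, one_mul]; ring

lemma integral_exp_complexGaussian {t : ℝ} (ht : t < 1) :
    ∫ z, Real.exp (t * ‖z‖ ^ 2) ∂complexGaussian = (1 - t)⁻¹ := by
  rw [integral_complexGaussian]
  have h := integral_norm_pow_mul_exp 0 (sub_pos.2 ht)
  calc _ = ∫ z : ℂ, Real.pi⁻¹ * (‖z‖ ^ (2 * 0) * Real.exp (-(1 - t) * ‖z‖ ^ 2)) := by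
        congr 1; ext z
        simp only [smul_eq_mul, mul_zero, pow_zero, one_mul, mul_assoc, ← Real.exp_add]
        congr 2; ring
    _ = _ := by
        rw [integral_const_mul, h]; field_simp; simp

lemma integrable_exp_complexGaussian {t : ℝ} (ht : t < 1) :
    Integrable (fun z => Real.exp (t * ‖z‖ ^ 2)) complexGaussian := by
  refine not_imp_comm.1 integral_undef ?_
  rw [integral_exp_complexGaussian ht]
  exact inv_ne_zero (sub_pos.2 ht).ne'

instance : IsProbabilityMeasure complexGaussian := by
  have h := integral_norm_pow_complexGaussian 0
  have hi := integrable_norm_pow_complexGaussian 0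
  simp only [mul_zero, pow_zero, Nat.factorial_zero, Nat.cast_one] at h hi
  have : IsFiniteMeasure complexGaussian := by
    simpa [integrable_const_iff] using hi
  rw [integral_const, smul_eq_mul, mul_one] at h
  refine ⟨?_⟩
  rw [Measure.real, ENNReal.toReal_eq_one_iff] at h
  exact h

lemma integrable_pow_mul_conj_pow (a b : ℕ) :
    Integrable (fun z : ℂ => z ^ a * conj z ^ b) complexGaussian := by
  have h := (integrable_norm_pow_complexGaussian a).add (integrable_norm_pow_complexGaussian b)
  refine h.mono' (by fun_prop) (.of_forall fun z => ?_)
  simp only [norm_mul, norm_pow, RCLike.norm_conj, Pi.add_apply, pow_mul']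
  nlinarith [sq_nonneg (‖z‖ ^ a - ‖z‖ ^ b), sq_nonneg (‖z‖ ^ a), sq_nonneg (‖z‖ ^ b)]

lemma integral_complexGaussian_comp_mul (w : Circle) (f : ℂ → ℂ) :
    ∫ z, f (w * z) ∂complexGaussian = ∫ z, f z ∂complexGaussian := by
  rw [integral_complexGaussian, integral_complexGaussian]
  have h := (rotation w).measurePreserving.integral_comp
    (rotation w).toHomeomorph.measurableEmbedding
    (fun z : ℂ => (Real.pi⁻¹ * Real.exp (-‖z‖ ^ 2)) • f z)
  rw [← h]
  simp only [rotation_apply, norm_mul, Circle.norm_coe, one_mul]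

lemma integral_pow_mul_conj_pow (a b : ℕ) :
    ∫ z, z ^ a * conj z ^ b ∂complexGaussian = if a = b then (a ! : ℂ) else 0 := by
  split_ifs with hab
  · subst hab
    have : (fun z : ℂ => z ^ a * conj z ^ a) = fun z : ℂ => ((‖z‖ ^ (2 * a) : ℝ) : ℂ) := by
      ext z
      rw [← mul_pow, Complex.mul_conj, Complex.normSq_eq_norm_sq, pow_mul]; push_cast; rfl
    rw [this, integral_complex_ofReal, integral_norm_pow_complexGaussian]
    simp
  · set J := ∫ z, z ^ a * conj z ^ b ∂complexGaussian with hJ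
    -- Rotation by one radian serves all exponents at once: `exp (i a) = exp (i b)` with `a ≠ b`
    -- would make `π` rational.
    let w : Circle := Circle.exp 1
    have h := integral_complexGaussian_comp_mul w fun z => z ^ a * conj z ^ b
    have h2 : (w : ℂ) ^ a * conj (w : ℂ) ^ b * J = J := by
      rw [hJ, ← integral_const_mul]
      conv_rhs => rw [← h]
      congr 1; ext z; simp only [map_mul]; ring
    by_contra hne
    have h3 : (w : ℂ) ^ a * conj (w : ℂ) ^ b = 1 := by
      exact mul_right_cancel₀ hne (by rw [h2, one_mul])
    have h4 : (w : ℂ) ^ a = (w : ℂ) ^ b := by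
      have hw : conj (w : ℂ) ^ b * (w : ℂ) ^ b = 1 := by
        rw [← mul_pow, mul_comm, Complex.mul_conj]; simp
      calc (w : ℂ) ^ a = (w : ℂ) ^ a * (conj (w : ℂ) ^ b * (w : ℂ) ^ b) := by rw [hw, mul_one]
        _ = _ := by rw [← mul_assoc, h3, one_mul]
    simp only [w, Circle.coe_exp, ← Complex.exp_nat_mul] at h4
    rw [Complex.exp_eq_exp_iff_exists_int] at h4
    obtain ⟨n, hn⟩ := h4
    have him := congrArg Complex.im hn
    simp at him
    have hn0 : (n : ℝ) ≠ 0 := by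
      rintro h0
      rw [h0] at him
      apply hab
      have : (a : ℝ) = b := by linarith
      exact_mod_cast this
    have : Real.pi = (((a : ℚ) - b) / (2 * n) : ℚ) := by
      push_cast
      field_simp
      linarith
    exact irrational_pi ⟨_, this.symm⟩

section Pi

variable {I : Type} [Fintype I]

/-- The law of a family of independent standard complex Gaussians. -/
noncomputable def gaussianFamily (I : Type) [Fintype I] : Measure (I → ℂ) :=
  Measure.pi fun _ => complexGaussian

instance : IsProbabilityMeasure (gaussianFamily I) := by
  unfold gaussianFamily; infer_instance

lemma integrable_monomial (α β : I → ℕ) :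
    Integrable (fun z : I → ℂ => ∏ i, z i ^ α i * conj (z i) ^ β i) (gaussianFamily I) :=
  Integrable.fintype_prod fun i => integrable_pow_mul_conj_pow (α i) (β i)

/-- The product of the factorials of the entries of a multi-index. -/
def multiFactorial (α : I → ℕ) : ℕ := ∏ i, (α i)!

lemma integral_monomial (α β : I → ℕ) :
    ∫ z : I → ℂ, ∏ i, z i ^ α i * conj (z i) ^ β i ∂(gaussianFamily I) =
      if α = β then (multiFactorial α : ℂ) else 0 := by
  rw [gaussianFamily, integral_fintype_prod_eq_prod (fun i (w : ℂ) => w ^ α i * conj w ^ β i)]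
  simp only [integral_pow_mul_conj_pow]
  split_ifs with h
  · subst h; simp [multiFactorial]
  · obtain ⟨i, hi⟩ := Function.ne_iff.1 h
    exact Finset.prod_eq_zero (Finset.mem_univ i) (if_neg hi)

end Pi

/-! ### Bombieri's inequality for Gaussian norms of homogeneous polynomials. -/

section Bombieri

variable {I : Type} [Fintype I]

lemma prod_mul_conj_prod (z : I → ℂ) (α β : I → ℕ) :
    (∏ i, z i ^ α i) * conj (∏ i, z i ^ β i) = ∏ i, z i ^ α i * conj (z i) ^ β i := by
  rw [map_prod, ← Finset.prod_mul_distrib]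
  simp only [map_pow]

lemma sum_mul_conj_sum_eq {J K : Type*} (s : Finset J) (t : Finset K) (c : J → ℂ) (c' : K → ℂ)
    (e : J → I → ℕ) (e' : K → I → ℕ) (z : I → ℂ) :
    (∑ j ∈ s, c j * ∏ i, z i ^ e j i) * conj (∑ l ∈ t, c' l * ∏ i, z i ^ e' l i) =
      ∑ j ∈ s, ∑ l ∈ t, (c j * conj (c' l)) * ∏ i, z i ^ e j i * conj (z i) ^ e' l i := by
  rw [map_sum, Finset.sum_mul_sum]
  refine Finset.sum_congr rfl fun j _ => Finset.sum_congr rfl fun l _ => ?_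
  rw [← prod_mul_conj_prod, map_mul]
  ring

lemma integrable_sum_mul_conj_sum {J K : Type*} (s : Finset J) (t : Finset K) (c : J → ℂ)
    (c' : K → ℂ) (e : J → I → ℕ) (e' : K → I → ℕ) :
    Integrable (fun z : I → ℂ => (∑ j ∈ s, c j * ∏ i, z i ^ e j i) *
      conj (∑ l ∈ t, c' l * ∏ i, z i ^ e' l i)) (gaussianFamily I) := by
  simp only [sum_mul_conj_sum_eq]
  exact integrable_finsetSum _ fun j _ => integrable_finsetSum _ fun l _ =>
    (integrable_monomial _ _).const_mul _

lemma integral_sum_mul_conj_sum {J K : Type*} (s : Finset J) (t : Finset K) (c : J → ℂ)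
    (c' : K → ℂ) (e : J → I → ℕ) (e' : K → I → ℕ) :
    ∫ z : I → ℂ, (∑ j ∈ s, c j * ∏ i, z i ^ e j i) *
      conj (∑ l ∈ t, c' l * ∏ i, z i ^ e' l i) ∂(gaussianFamily I) =
    ∑ j ∈ s, ∑ l ∈ t, (c j * conj (c' l)) *
      if e j = e' l then (multiFactorial (e j) : ℂ) else 0 := by
  simp only [sum_mul_conj_sum_eq]
  rw [integral_finsetSum _ fun j _ => integrable_finsetSum _ fun l _ =>
    (integrable_monomial _ _).const_mul _]
  refine Finset.sum_congr rfl fun j _ => ?_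
  rw [integral_finsetSum _ fun l _ => (integrable_monomial _ _).const_mul _]
  refine Finset.sum_congr rfl fun l _ => ?_
  rw [integral_const_mul, integral_monomial]

/-- The weight of the `2 × 2` contingency tables with diagonal `(i, h)` whose first row sums to
`a` and second column sums to `e`. -/
noncomputable def tableWeight (i h a e : ℕ) : ℝ :=
  if i ≤ a ∧ h ≤ e ∧ a - i = e - h then ((a - i)! : ℝ)⁻¹ else 0

/-- The left side sums, over the `2 × 2` tables with row sums `a, b` and column sums `c, e`, the
inverse product of the factorials of the entries; the two weights supply the off-diagonal entries.
Multiplied by `a! b!`, it is Vandermonde's convolution for `(a + b).choose c`. -/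
lemma sum_tableWeight {a b c e N : ℕ} (ha : a ≤ N) (he : e ≤ N) :
    ∑ i ∈ Finset.range (N + 1), ∑ h ∈ Finset.range (N + 1),
      ((i ! : ℝ)⁻¹ * (h ! : ℝ)⁻¹) * (tableWeight i h a e * tableWeight i h c b) =
    if a + b = c + e then ((a + b)! : ℝ) / (a ! * b ! * c ! * e !) else 0 := by
  split_ifs with hs
  · have hV := Nat.add_choose_eq a b c
    have hcn : c ≤ a + b := by omega
    have hsub : a + b - c = e := by omega
    have h1 : ((a + b)! : ℝ) = (a + b).choose c * c ! * e ! := by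
      rw [← hsub]; exact_mod_cast (Nat.choose_mul_factorial_mul_factorial hcn).symm
    have h2 : ((a + b)! : ℝ) / (a ! * b ! * c ! * e !) = (a + b).choose c / (a ! * b !) := by
      rw [h1]; field_simp
    rw [h2, hV, Finset.Nat.sum_antidiagonal_eq_sum_range_succ_mk]
    push_cast
    rw [Finset.sum_div]
    have h3 : ∀ i, ∑ h ∈ Finset.range (N + 1),
        ((i ! : ℝ)⁻¹ * (h ! : ℝ)⁻¹) * (tableWeight i h a e * tableWeight i h c b) =
        if i ≤ c then ((a.choose i : ℝ) * (b.choose (c - i))) / (a ! * b !) else 0 := by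
      intro i
      by_cases hi : i ≤ a ∧ i ≤ c ∧ a ≤ e + i
      · obtain ⟨hia, hic, hei⟩ := hi
        -- The corner `i` and the margins determine the opposite corner.
        rw [if_pos hic, Finset.sum_eq_single (e + i - a)]
        · rw [tableWeight, tableWeight, if_pos (by omega), if_pos (by omega)]
          have hcb : c - i ≤ b := by omega
          rw [Nat.cast_choose ℝ hia, Nat.cast_choose ℝ hcb,
            show b - (c - i) = e + i - a by omega]
          field_simp
        · intro h _ hne
          rw [tableWeight, if_neg (by omega)]; ring
        · intro hn
          simp only [Finset.mem_range] at hn; omega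
      · rw [Finset.sum_eq_zero]
        · split_ifs with hic
          · by_cases hia : i ≤ a
            · rw [Nat.choose_eq_zero_of_lt (show b < c - i by omega)]; simp
            · rw [Nat.choose_eq_zero_of_lt (show a < i by omega)]; simp
          · rfl
        · intro h _
          by_cases hia : i ≤ a ∧ h ≤ e ∧ a - i = e - h
          · rw [tableWeight, tableWeight, if_neg (c := i ≤ c ∧ _) (by omega)]; ring
          · rw [tableWeight, if_neg hia]; ring
    simp only [h3]
    rw [← Finset.sum_filter]
    have hsplit : ∀ i, a < i → ((a.choose i : ℝ) * (b.choose (c - i))) / (a ! * b !) = 0 := by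
      intro i hi; rw [Nat.choose_eq_zero_of_lt hi]; simp
    refine Finset.sum_subset_zero_on_sdiff ?_ ?_ (fun _ _ => rfl)
    · intro i; simp only [Finset.mem_filter, Finset.mem_range]; omega
    · intro i; simp only [Finset.mem_sdiff, Finset.mem_filter, Finset.mem_range]
      intro hi; exact hsplit i (by omega)
  · refine Finset.sum_eq_zero fun i _ => Finset.sum_eq_zero fun h _ => ?_
    by_cases hia : i ≤ a ∧ h ≤ e ∧ a - i = e - h
    · rw [tableWeight, tableWeight, if_neg (c := i ≤ c ∧ _) (by omega)]; ring
    · rw [tableWeight, if_neg hia]; ring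

/-- The product of the table weights over all coordinates. -/
noncomputable def multiTableWeight (ι η α ε : I → ℕ) : ℝ :=
  ∏ i, tableWeight (ι i) (η i) (α i) (ε i)

/-- The multi-indices with all entries at most `N`. -/
def multiIndexBox (I : Type) [Fintype I] [DecidableEq I] (N : ℕ) : Finset (I → ℕ) :=
  Fintype.piFinset fun _ => Finset.range (N + 1)

lemma sum_multiTableWeight [DecidableEq I] {α β γ ε : I → ℕ} {N : ℕ} (hα : ∀ i, α i ≤ N)
    (hε : ∀ i, ε i ≤ N) :
    ∑ ι ∈ multiIndexBox I N, ∑ η ∈ multiIndexBox I N,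
      ((multiFactorial ι : ℝ)⁻¹ * (multiFactorial η : ℝ)⁻¹) *
        (multiTableWeight ι η α ε * multiTableWeight ι η γ β) =
    if α + β = γ + ε then (multiFactorial (α + β) : ℝ) /
      (multiFactorial α * multiFactorial β * multiFactorial γ * multiFactorial ε) else 0 := by
  have h1 : ∀ ι η : I → ℕ, ((multiFactorial ι : ℝ)⁻¹ * (multiFactorial η : ℝ)⁻¹) *
        (multiTableWeight ι η α ε * multiTableWeight ι η γ β) =
      ∏ i, (((ι i)! : ℝ)⁻¹ * ((η i)! : ℝ)⁻¹) *
        (tableWeight (ι i) (η i) (α i) (ε i) * tableWeight (ι i) (η i) (γ i) (β i)) := by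
    intro ι η
    simp only [multiFactorial, multiTableWeight, Nat.cast_prod, Finset.prod_mul_distrib,
      Finset.prod_inv_distrib]
  simp only [h1, multiIndexBox]
  have h2 : ∀ ι : I → ℕ, ∑ η ∈ Fintype.piFinset fun _ : I => Finset.range (N + 1),
      ∏ i, (((ι i)! : ℝ)⁻¹ * ((η i)! : ℝ)⁻¹) *
        (tableWeight (ι i) (η i) (α i) (ε i) * tableWeight (ι i) (η i) (γ i) (β i)) =
      ∏ i, ∑ h ∈ Finset.range (N + 1), (((ι i)! : ℝ)⁻¹ * (h ! : ℝ)⁻¹) *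
        (tableWeight (ι i) h (α i) (ε i) * tableWeight (ι i) h (γ i) (β i)) := by
    intro ι
    rw [Finset.prod_univ_sum]
  simp only [h2]
  rw [← Finset.prod_univ_sum (fun _ => Finset.range (N + 1)) (fun i j =>
    ∑ h ∈ Finset.range (N + 1), ((j ! : ℝ)⁻¹ * (h ! : ℝ)⁻¹) *
        (tableWeight j h (α i) (ε i) * tableWeight j h (γ i) (β i)))]
  simp only [sum_tableWeight (hα _) (hε _)]
  split_ifs with h
  · simp only [multiFactorial, Nat.cast_prod, ← Finset.prod_mul_distrib, ← Finset.prod_div_distrib]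
    refine Finset.prod_congr rfl fun i _ => ?_
    rw [if_pos (show α i + β i = γ i + ε i from congrFun h i)]; rfl
  · obtain ⟨i, hi⟩ := Function.ne_iff.1 h
    exact Finset.prod_eq_zero (Finset.mem_univ i) (if_neg hi)

lemma multiFactorial_pos (α : I → ℕ) : 0 < multiFactorial α :=
  Finset.prod_pos fun _ _ => Nat.factorial_pos _

/-- A nonzero weight requires `ι ≤ α` entrywise; equal totals then force `ι = α`, so all
off-diagonal entries vanish. -/
lemma multiTableWeight_eq_of_sum_eq {ι η α ε : I → ℕ} (hι : ∑ i, ι i = ∑ i, α i) :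
    multiTableWeight ι η α ε = if ι = α ∧ η = ε then 1 else 0 := by
  classical
  split_ifs with h
  · obtain ⟨rfl, rfl⟩ := h
    simp [multiTableWeight, tableWeight]
  · by_cases hle : ∀ i, ι i ≤ α i
    · have h1 : ι = α := by
        funext i
        exact (Finset.sum_eq_sum_iff_of_le fun i _ => hle i).1 hι i (Finset.mem_univ i)
      subst h1
      have h2 : η ≠ ε := fun h2 => h ⟨rfl, h2⟩
      obtain ⟨i, hi⟩ := Function.ne_iff.1 h2
      refine Finset.prod_eq_zero (Finset.mem_univ i) (if_neg ?_)
      omega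
    · push Not at hle
      obtain ⟨i, hi⟩ := hle
      exact Finset.prod_eq_zero (Finset.mem_univ i) (if_neg (by omega))

/-- The squared norm of `P` in `L²` of the Gaussian measure. -/
noncomputable def gaussianNormSq (P : MvPolynomial I ℂ) : ℝ :=
  ∫ z, ‖MvPolynomial.eval z P‖ ^ 2 ∂(gaussianFamily I)

lemma integrable_norm_eval_sq (P : MvPolynomial I ℂ) :
    Integrable (fun z => ‖MvPolynomial.eval z P‖ ^ 2) (gaussianFamily I) := by
  have h := integrable_sum_mul_conj_sum P.support P.support P.coeff P.coeff
    (fun d => (d : I → ℕ)) (fun d => (d : I → ℕ))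
  simp only [← MvPolynomial.eval_eq'] at h
  refine h.re.congr (.of_forall fun z => ?_)
  simp only [Complex.mul_conj, Complex.normSq_eq_norm_sq, RCLike.re_to_complex, Complex.ofReal_re]

lemma ofReal_integral_norm_sq (f : (I → ℂ) → ℂ) :
    ((∫ z, ‖f z‖ ^ 2 ∂(gaussianFamily I) : ℝ) : ℂ) =
      ∫ z, f z * conj (f z) ∂(gaussianFamily I) := by
  rw [← integral_complex_ofReal]
  simp only [Complex.mul_conj, Complex.normSq_eq_norm_sq]

lemma gaussianNormSq_eq (P : MvPolynomial I ℂ) :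
    gaussianNormSq P = ∑ d ∈ P.support, multiFactorial d * ‖P.coeff d‖ ^ 2 := by
  classical
  apply Complex.ofReal_injective
  rw [gaussianNormSq, ofReal_integral_norm_sq]
  simp only [MvPolynomial.eval_eq']
  rw [integral_sum_mul_conj_sum]
  push_cast
  refine Finset.sum_congr rfl fun d hd => ?_
  simp only [DFunLike.coe_fn_eq, mul_ite, mul_zero, Finset.sum_ite_eq, if_pos hd]
  rw [Complex.mul_conj, Complex.normSq_eq_norm_sq]
  push_cast; ring

lemma gaussianNormSq_mul_eq (P Q : MvPolynomial I ℂ) :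
    (gaussianNormSq (P * Q) : ℂ) = ∑ j ∈ P.support ×ˢ Q.support, ∑ l ∈ P.support ×ˢ Q.support,
      ((P.coeff j.1 * Q.coeff j.2) * conj (P.coeff l.1 * Q.coeff l.2)) *
        if (j.1 + j.2 : I → ℕ) = l.1 + l.2 then (multiFactorial (j.1 + j.2 : I → ℕ) : ℂ) else 0 := by
  have h : ∀ z : I → ℂ, MvPolynomial.eval z (P * Q) = ∑ j ∈ P.support ×ˢ Q.support,
      (P.coeff j.1 * Q.coeff j.2) * ∏ i, z i ^ (j.1 + j.2 : I → ℕ) i := by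
    intro z
    rw [map_mul, MvPolynomial.eval_eq', MvPolynomial.eval_eq', Finset.sum_mul_sum,
      Finset.sum_product]
    refine Finset.sum_congr rfl fun a _ => Finset.sum_congr rfl fun b _ => ?_
    simp only [Pi.add_apply, pow_add, Finset.prod_mul_distrib]
    ring
  rw [gaussianNormSq, ofReal_integral_norm_sq]
  simp only [h]
  exact integral_sum_mul_conj_sum _ _ _ _ _ _

/-- **Bombieri's inequality** in Gaussian form. -/
theorem gaussianNormSq_mul_le {P Q : MvPolynomial I ℂ} {a b : ℕ} (hP : P.IsHomogeneous a)
    (hQ : Q.IsHomogeneous b) :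
    gaussianNormSq P * gaussianNormSq Q ≤ gaussianNormSq (P * Q) := by
  classical
  have degP : ∀ d ∈ P.support, ∑ i, d i = a := fun d hd => by
    have := hP (MvPolynomial.mem_support_iff.1 hd)
    rw [Finsupp.weight_apply, Finsupp.sum_fintype _ _ (by simp)] at this
    simpa using this
  have degQ : ∀ d ∈ Q.support, ∑ i, d i = b := fun d hd => by
    have := hQ (MvPolynomial.mem_support_iff.1 hd)
    rw [Finsupp.weight_apply, Finsupp.sum_fintype _ _ (by simp)] at this
    simpa using this
  set N := a + b
  have leP : ∀ d ∈ P.support, ∀ i, d i ≤ N := fun d hd i =>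
    (Finset.single_le_sum (f := fun i => d i) (fun _ _ => Nat.zero_le _) (Finset.mem_univ i)).trans
      (by rw [degP d hd]; omega)
  have leQ : ∀ d ∈ Q.support, ∀ i, d i ≤ N := fun d hd i =>
    (Finset.single_le_sum (f := fun i => d i) (fun _ _ => Nat.zero_le _) (Finset.mem_univ i)).trans
      (by rw [degQ d hd]; omega)
  -- `Q` enters conjugated, so that expanding `‖V ι η‖ ^ 2` pairs the exponents of `P` and `Q`
  -- crosswise, as the margins of contingency tables.
  let V : (I → ℕ) → (I → ℕ) → ℂ := fun ι η => ∑ j ∈ P.support ×ˢ Q.support,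
    (P.coeff j.1 * conj (Q.coeff j.2) * (multiFactorial j.1 * multiFactorial j.2)) *
      multiTableWeight ι η j.1 j.2
  have key : gaussianNormSq (P * Q) = ∑ ι ∈ multiIndexBox I N, ∑ η ∈ multiIndexBox I N,
      ((multiFactorial ι : ℝ)⁻¹ * (multiFactorial η : ℝ)⁻¹) * ‖V ι η‖ ^ 2 := by
    apply Complex.ofReal_injective
    rw [gaussianNormSq_mul_eq]
    push_cast
    have hV : ∀ ι η, ((‖V ι η‖ : ℂ)) ^ 2 = ∑ j ∈ P.support ×ˢ Q.support,
        ∑ l ∈ P.support ×ˢ Q.support,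
        (P.coeff j.1 * conj (Q.coeff j.2) * (multiFactorial j.1 * multiFactorial j.2) *
          conj (P.coeff l.1 * conj (Q.coeff l.2) * (multiFactorial l.1 * multiFactorial l.2))) *
        ((multiTableWeight ι η j.1 j.2 * multiTableWeight ι η l.1 l.2 : ℝ) : ℂ) := by
      intro ι η
      rw [← Complex.ofReal_pow, ← Complex.normSq_eq_norm_sq, ← Complex.mul_conj]
      simp only [V]
      rw [map_sum, Finset.sum_mul_sum]
      refine Finset.sum_congr rfl fun j _ => Finset.sum_congr rfl fun l _ => ?_
      simp only [map_mul, Complex.conj_ofReal]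
      push_cast
      ring
    simp only [hV, Finset.mul_sum]
    have swap : ∀ G : (I → ℕ) → (I → ℕ) → ((I →₀ ℕ) × (I →₀ ℕ)) → ((I →₀ ℕ) × (I →₀ ℕ)) → ℂ,
        ∑ ι ∈ multiIndexBox I N, ∑ η ∈ multiIndexBox I N, ∑ j ∈ P.support ×ˢ Q.support,
          ∑ l ∈ P.support ×ˢ Q.support, G ι η j l =
        ∑ j ∈ P.support ×ˢ Q.support, ∑ l ∈ P.support ×ˢ Q.support,
          ∑ ι ∈ multiIndexBox I N, ∑ η ∈ multiIndexBox I N, G ι η j l := by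
      intro G
      calc _ = ∑ x ∈ multiIndexBox I N ×ˢ multiIndexBox I N,
            ∑ y ∈ (P.support ×ˢ Q.support) ×ˢ (P.support ×ˢ Q.support), G x.1 x.2 y.1 y.2 := by
            simp only [Finset.sum_product]
        _ = _ := Finset.sum_comm
        _ = _ := by simp only [Finset.sum_product]
    rw [swap]
    -- Exchanging the `Q`-exponents of the product and of its conjugate brings the expansion of
    -- `gaussianNormSq (P * Q)` into the crosswise form of `V`.
    have relabel : ∀ G : (I →₀ ℕ) → (I →₀ ℕ) → (I →₀ ℕ) → (I →₀ ℕ) → ℂ,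
        ∑ j ∈ P.support ×ˢ Q.support, ∑ l ∈ P.support ×ˢ Q.support, G j.1 j.2 l.1 l.2 =
        ∑ j ∈ P.support ×ˢ Q.support, ∑ l ∈ P.support ×ˢ Q.support, G j.1 l.2 l.1 j.2 := by
      intro G
      simp only [Finset.sum_product]
      refine Finset.sum_congr rfl fun x _ => ?_
      rw [Finset.sum_comm]
      conv_rhs => rw [Finset.sum_comm]
      refine Finset.sum_congr rfl fun y _ => ?_
      rw [Finset.sum_comm]
    rw [relabel fun α β γ ε => ((P.coeff α * Q.coeff β) * conj (P.coeff γ * Q.coeff ε)) *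
        if (α + β : I → ℕ) = γ + ε then (multiFactorial (α + β : I → ℕ) : ℂ) else 0]
    refine Finset.sum_congr rfl fun j hj => Finset.sum_congr rfl fun l hl => ?_
    rw [Finset.mem_product] at hj hl
    have ht := sum_multiTableWeight (α := j.1) (β := l.2) (γ := l.1) (ε := j.2) (N := N)
      (leP _ hj.1) (leQ _ hj.2)
    have ht' := congrArg (fun x : ℝ => (x : ℂ)) ht
    simp only [Complex.ofReal_sum, Complex.ofReal_mul] at ht'
    have hpull : ∀ (x : ℂ) (f g : (I → ℕ) → (I → ℕ) → ℂ),
        ∑ ι ∈ multiIndexBox I N, ∑ η ∈ multiIndexBox I N, f ι η * (x * g ι η) =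
        x * ∑ ι ∈ multiIndexBox I N, ∑ η ∈ multiIndexBox I N, f ι η * g ι η := by
      intro x f g
      simp only [Finset.mul_sum]
      exact Finset.sum_congr rfl fun _ _ => Finset.sum_congr rfl fun _ _ => by ring
    rw [hpull]
    simp only [Complex.ofReal_inv, Complex.ofReal_natCast] at ht'
    simp only [Complex.ofReal_mul]
    rw [ht']
    have p1 := (multiFactorial_pos (j.1 : I → ℕ)).ne'
    have p2 := (multiFactorial_pos (j.2 : I → ℕ)).ne'
    have p3 := (multiFactorial_pos (l.1 : I → ℕ)).ne'
    have p4 := (multiFactorial_pos (l.2 : I → ℕ)).ne'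
    split_ifs with hs
    · simp only [map_mul, Complex.conj_conj, map_natCast]
      push_cast
      field_simp
    · simp
  have hVsupp : ∀ ι ∈ P.support, ∀ η ∈ Q.support,
      V ι η = P.coeff ι * conj (Q.coeff η) * (multiFactorial ι * multiFactorial η) := by
    intro ι hι η hη
    simp only [V]
    rw [Finset.sum_eq_single (ι, η)]
    · rw [multiTableWeight_eq_of_sum_eq rfl]; simp
    · rintro ⟨α, ε⟩ hj hne
      rw [Finset.mem_product] at hj
      rw [multiTableWeight_eq_of_sum_eq (by rw [degP _ hι, degP _ hj.1]), if_neg]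
      · simp
      · rintro ⟨h1, h2⟩
        exact hne (by rw [Prod.mk.injEq]; exact ⟨(DFunLike.coe_injective h1).symm,
          (DFunLike.coe_injective h2).symm⟩)
    · intro hn
      exact absurd (Finset.mk_mem_product hι hη) hn
  have hbox : ∀ s : Finset (I →₀ ℕ), (∀ d ∈ s, ∀ i, d i ≤ N) →
      s.map ⟨fun d : I →₀ ℕ => (d : I → ℕ), DFunLike.coe_injective⟩ ⊆ multiIndexBox I N := by
    intro s hs x hx
    obtain ⟨d, hd, rfl⟩ := Finset.mem_map.1 hx
    simp only [multiIndexBox, Fintype.mem_piFinset, Finset.mem_range]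
    exact fun i => Nat.lt_succ_of_le (hs d hd i)
  rw [key, gaussianNormSq_eq, gaussianNormSq_eq, Finset.sum_mul_sum]
  have hnn : ∀ ι η : I → ℕ,
      0 ≤ ((multiFactorial ι : ℝ)⁻¹ * (multiFactorial η : ℝ)⁻¹) * ‖V ι η‖ ^ 2 :=
    fun ι η => by positivity
  -- In the sum of squares `key`, the terms with `ι` in the support of `P` and `η` in that of `Q`
  -- already give the product of the norms; the others are nonnegative and are dropped.
  refine le_trans ?_ (Finset.sum_le_sum_of_subset_of_nonneg (hbox _ leP)
    fun ι _ _ => Finset.sum_nonneg fun η _ => hnn ι η)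
  rw [Finset.sum_map]
  refine Finset.sum_le_sum fun ι hι => ?_
  refine le_trans ?_ (Finset.sum_le_sum_of_subset_of_nonneg (hbox _ leQ) fun η _ _ => hnn _ η)
  rw [Finset.sum_map]
  refine Finset.sum_le_sum fun η hη => ?_
  simp only [Function.Embedding.coeFn_mk]
  rw [hVsupp ι hι η hη]
  simp only [norm_mul, RCLike.norm_conj, Complex.norm_natCast]
  have p1 := (multiFactorial_pos (ι : I → ℕ)).ne'
  have p2 := (multiFactorial_pos (η : I → ℕ)).ne'
  apply le_of_eq
  field_simp

theorem prod_gaussianNormSq_le {T : Type*} (s : Finset T) (P : T → MvPolynomial I ℂ) {k : ℕ}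
    (hP : ∀ t ∈ s, (P t).IsHomogeneous k) :
    ∏ t ∈ s, gaussianNormSq (P t) ≤ gaussianNormSq (∏ t ∈ s, P t) := by
  classical
  induction s using Finset.induction_on with
  | empty => simp [gaussianNormSq]
  | insert t s ht ih =>
    rw [Finset.prod_insert ht, Finset.prod_insert ht]
    have h1 := ih fun t' h' => hP t' (Finset.mem_insert_of_mem h')
    have h2 : (∏ t ∈ s, P t).IsHomogeneous (∑ _t ∈ s, k) :=
      MvPolynomial.IsHomogeneous.prod _ _ _ fun t' h' => hP t' (Finset.mem_insert_of_mem h')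
    refine le_trans ?_ (gaussianNormSq_mul_le (hP t (Finset.mem_insert_self _ _)) h2)
    exact mul_le_mul_of_nonneg_left h1 (integral_nonneg fun z => by positivity)

end Bombieri

/-! ### Wick's theorem. -/

section Wick

variable {I : Type} [Fintype I] {κ : Type} [Fintype κ] [DecidableEq κ] [DecidableEq I]

omit [DecidableEq κ] in
lemma prod_comp_eq_prod_pow (z : I → ℂ) (x : κ → I) :
    ∏ i, z (x i) = ∏ c, z c ^ Fintype.card {i // x i = c} := by
  rw [← Finset.prod_fiberwise (s := Finset.univ) (g := x)]
  refine Finset.prod_congr rfl fun c _ => ?_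
  rw [Finset.prod_congr rfl (g := fun _ => z c) (fun i hi => by
    rw [(Finset.mem_filter.1 hi).2]), Finset.prod_const, Fintype.card_subtype]

omit [Fintype I] in
lemma card_perm_comp_eq {x y : κ → I} {σ₀ : Equiv.Perm κ} (h : y ∘ σ₀ = x) :
    Fintype.card {σ : Equiv.Perm κ // y ∘ σ = x} =
      Fintype.card {σ : Equiv.Perm κ // x ∘ σ = x} := by
  refine Fintype.card_congr (Equiv.subtypeEquiv (Equiv.mulLeft σ₀) fun τ => ?_).symm
  rw [Equiv.coe_mulLeft, Equiv.Perm.coe_mul, ← Function.comp_assoc, h]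

/-- **Wick's theorem** for the complex Gaussian measure. -/
theorem integral_wick (x y : κ → I) :
    ∫ z : I → ℂ, ∏ i, z (x i) * conj (z (y i)) ∂(gaussianFamily I) =
      ∑ σ : Equiv.Perm κ, if y ∘ σ = x then 1 else 0 := by
  have h1 : ∀ z : I → ℂ, ∏ i, z (x i) * conj (z (y i)) =
      ∏ c, z c ^ Fintype.card {i // x i = c} * conj (z c) ^ Fintype.card {i // y i = c} := by
    intro z
    rw [Finset.prod_mul_distrib, Finset.prod_mul_distrib, prod_comp_eq_prod_pow z x,
      prod_comp_eq_prod_pow (fun c => conj (z c)) y]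
  simp only [h1]
  rw [integral_monomial (fun c => Fintype.card {i // x i = c})
    (fun c => Fintype.card {i // y i = c}), Finset.sum_boole, ← Fintype.card_subtype]
  split_ifs with h
  · have hex : ∃ σ : Equiv.Perm κ, y ∘ σ = x := by
      have e : ∀ c, {i // x i = c} ≃ {i // y i = c} :=
        fun c => (Fintype.card_eq.1 (congrFun h c)).some
      exact ⟨Equiv.ofFiberEquiv e, funext fun i => Equiv.ofFiberEquiv_map e i⟩
    obtain ⟨σ₀, h0⟩ := hex
    -- The permutations carrying `y` to `x` form a coset of the stabilizer of `x`, whose order is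
    -- the product of the factorials of the multiplicities.
    rw [card_perm_comp_eq h0, DomMulAct.stabilizer_card]
    rfl
  · rw [eq_comm, Nat.cast_eq_zero, Fintype.card_eq_zero_iff]
    refine ⟨fun ⟨σ, hσ⟩ => h (funext fun c => ?_)⟩
    refine Fintype.card_congr (Equiv.subtypeEquiv σ fun i => ?_)
    rw [← hσ]; rfl

end Wick

/-! ### Polynomials in `z` and its conjugate, as a supply of integrable functions. -/

section MixedPolynomial

variable {I : Type} [Fintype I]

/-- The function is a polynomial in the variables and their conjugates. -/
def IsMixedPolynomial (f : (I → ℂ) → ℂ) : Prop :=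
  ∃ P : MvPolynomial (I ⊕ I) ℂ, ∀ z, f z = MvPolynomial.eval (Sum.elim z fun i => conj (z i)) P

namespace IsMixedPolynomial

omit [Fintype I]

lemma const (c : ℂ) : IsMixedPolynomial fun _ : I → ℂ => c := ⟨MvPolynomial.C c, by simp⟩

lemma var (i : I) : IsMixedPolynomial fun z : I → ℂ => z i := ⟨MvPolynomial.X (.inl i), by simp⟩

lemma conj_var (i : I) : IsMixedPolynomial fun z : I → ℂ => conj (z i) :=
  ⟨MvPolynomial.X (.inr i), by simp⟩

lemma add {f g : (I → ℂ) → ℂ} (hf : IsMixedPolynomial f) (hg : IsMixedPolynomial g) :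
    IsMixedPolynomial fun z => f z + g z := by
  obtain ⟨P, hP⟩ := hf
  obtain ⟨Q, hQ⟩ := hg
  exact ⟨P + Q, fun z => by simp only [map_add, hP, hQ]⟩

lemma mul {f g : (I → ℂ) → ℂ} (hf : IsMixedPolynomial f) (hg : IsMixedPolynomial g) :
    IsMixedPolynomial fun z => f z * g z := by
  obtain ⟨P, hP⟩ := hf
  obtain ⟨Q, hQ⟩ := hg
  exact ⟨P * Q, fun z => by simp only [map_mul, hP, hQ]⟩

lemma sum {J : Type*} {s : Finset J} {f : J → (I → ℂ) → ℂ} (h : ∀ j, IsMixedPolynomial (f j)) :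
    IsMixedPolynomial fun z => ∑ j ∈ s, f j z := by
  choose P hP using h
  exact ⟨∑ j ∈ s, P j, fun z => by simp only [map_sum, hP]⟩

lemma prod {J : Type*} {s : Finset J} {f : J → (I → ℂ) → ℂ} (h : ∀ j, IsMixedPolynomial (f j)) :
    IsMixedPolynomial fun z => ∏ j ∈ s, f j z := by
  choose P hP using h
  exact ⟨∏ j ∈ s, P j, fun z => by simp only [map_prod, hP]⟩

lemma pow {f : (I → ℂ) → ℂ} (h : IsMixedPolynomial f) (n : ℕ) :
    IsMixedPolynomial fun z => f z ^ n := by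
  obtain ⟨P, hP⟩ := h
  exact ⟨P ^ n, fun z => by simp only [map_pow, hP]⟩

end IsMixedPolynomial

lemma IsMixedPolynomial.integrable {f : (I → ℂ) → ℂ} (h : IsMixedPolynomial f) :
    Integrable f (gaussianFamily I) := by
  obtain ⟨P, hP⟩ := h
  have : f = fun z => ∑ d ∈ P.support, P.coeff d *
      ∏ i, z i ^ d (.inl i) * conj (z i) ^ d (.inr i) := by
    funext z
    rw [hP, MvPolynomial.eval_eq']
    simp only [Fintype.prod_sum_type, Sum.elim_inl, Sum.elim_inr, Finset.prod_mul_distrib]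
  rw [this]
  exact integrable_finsetSum _ fun d _ => (integrable_monomial _ _).const_mul _

end MixedPolynomial

/-! ### Permutation-invariant sums as products of power sums. -/

section PowerSums

variable {κ R : Type} [Fintype κ] [DecidableEq κ] [Fintype R] [DecidableEq R]

omit [DecidableEq R] [Fintype R] in
lemma apply_eq_of_sameCycle {r : κ → R} {σ : Equiv.Perm κ} (h : r ∘ σ = r) {i j : κ}
    (hij : σ.SameCycle i j) : r i = r j := by
  obtain ⟨n, -, -, rfl⟩ := hij.exists_pow_eq
  have : ∀ n : ℕ, r ((σ ^ n) i) = r i := by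
    intro n
    induction n with
    | zero => simp
    | succ n ih => rw [pow_succ', Equiv.Perm.mul_apply, ← ih]; exact congrFun h _
  exact (this n).symm

-- A labelling fixed by `σ` is constant on cycles, hence amounts to one free label per cycle, and
-- the sum factorises.
open Classical in
lemma sum_invariant_eq_prod_powerSum (σ : Equiv.Perm κ) (w : R → ℂ) :
    (∑ r : κ → R, if r ∘ σ = r then ∏ i, w (r i) else 0) =
      ∏ c : Quotient (Equiv.Perm.SameCycle.setoid σ),
        ∑ s, w s ^ Fintype.card {i // (⟦i⟧ : Quotient (Equiv.Perm.SameCycle.setoid σ)) = c} := by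
  rw [Finset.prod_univ_sum, Fintype.piFinset_univ, ← Finset.sum_filter]
  refine Finset.sum_bij' (fun r _ => fun c => r c.out) (fun s _ => fun i => s ⟦i⟧) ?_ ?_ ?_ ?_ ?_
  · simp
  · intro s _
    simp only [Finset.mem_filter, Finset.mem_univ, true_and]
    funext i
    exact congrArg s (Quotient.sound (Equiv.Perm.sameCycle_apply_left.2 (.refl σ i)))
  · intro r hr
    funext i
    exact apply_eq_of_sameCycle (Finset.mem_filter.1 hr).2 (Quotient.mk_out (s := Equiv.Perm.SameCycle.setoid σ) i)
  · intro s _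
    funext c
    simp
  · intro r hr
    have h1 : ∀ i, r i = r (⟦i⟧ : Quotient (Equiv.Perm.SameCycle.setoid σ)).out := fun i =>
      (apply_eq_of_sameCycle (Finset.mem_filter.1 hr).2
        (Quotient.mk_out (s := Equiv.Perm.SameCycle.setoid σ) i)).symm
    calc ∏ i, w (r i) = ∏ i, (fun c : Quotient (Equiv.Perm.SameCycle.setoid σ) =>
          w (r c.out)) (Quotient.mk _ i) := Finset.prod_congr rfl fun i _ => congrArg w (h1 i)
      _ = _ := prod_comp_eq_prod_pow (fun c => w (r (Quotient.out c)))
          (Quotient.mk (Equiv.Perm.SameCycle.setoid σ))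

/-- Only power sums with exponents equal to cycle lengths occur, and these lie between `1` and the
number of points. -/
lemma sum_invariant_eq_of_powerSum_eq (σ : Equiv.Perm κ) {w w' : R → ℂ}
    (h : ∀ i ∈ Finset.Icc 1 (Fintype.card κ), ∑ r, w r ^ i = ∑ r, w' r ^ i) :
    (∑ r : κ → R, if r ∘ σ = r then ∏ i, w (r i) else 0) =
      ∑ r : κ → R, if r ∘ σ = r then ∏ i, w' (r i) else 0 := by
  classical
  have e := sum_invariant_eq_prod_powerSum σ w
  have e' := sum_invariant_eq_prod_powerSum σ w'
  have h2 : ∀ c : Quotient (Equiv.Perm.SameCycle.setoid σ),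
      Fintype.card {i // (⟦i⟧ : Quotient (Equiv.Perm.SameCycle.setoid σ)) = c} ∈
        Finset.Icc 1 (Fintype.card κ) := by
    intro c
    rw [Finset.mem_Icc]
    refine ⟨Fintype.card_pos_iff.2 ⟨⟨c.out, Quotient.out_eq c⟩⟩, Fintype.card_subtype_le _⟩
  simp only [fun c => h _ (h2 c)] at e
  convert e.trans e'.symm

end PowerSums

/-! ### The random state and its mean tensor power. -/

section GaussianState

variable {d : ℕ}

/-- The unnormalised random state `∑ r, p r |g r⟩⟨g r| / d`, where the `g r` are the columns
of `z`. -/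
noncomputable def gaussianState (p : Fin d → ℝ) (z : Fin d × Fin d → ℂ) :
    Matrix (Fin d) (Fin d) ℂ :=
  Matrix.of fun i j => ∑ r, ((p r / d : ℝ) : ℂ) * (z (i, r) * conj (z (j, r)))

/-- The expected tensor power of `gaussianState p`. -/
noncomputable def meanTensorPower (p : Fin d → ℝ) (k : ℕ) :
    Matrix (Fin k → Fin d) (Fin k → Fin d) ℂ :=
  Matrix.of fun a b => ∫ z, tensorPower (gaussianState p z) k a b ∂(gaussianFamily _)

lemma isMixedPolynomial_gaussianState (p : Fin d → ℝ) (i j : Fin d) :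
    IsMixedPolynomial fun z => gaussianState p z i j := by
  simp only [gaussianState, Matrix.of_apply]
  exact .sum fun _ => .mul (.const _) (.mul (.var _) (.conj_var _))

lemma isMixedPolynomial_tensorPower (p : Fin d → ℝ) (k : ℕ) (a b : Fin k → Fin d) :
    IsMixedPolynomial fun z => tensorPower (gaussianState p z) k a b := by
  simp only [tensorPower, Matrix.of_apply]
  exact .prod fun _ => isMixedPolynomial_gaussianState p _ _

/-- Wick's theorem is applied to the index pairs `(a i, r i)` and `(b i, r i)`. Its matching
condition splits into one on the matrix indices and one on the labels `r`, and only the latter sees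
`p`. -/
lemma meanTensorPower_apply (p : Fin d → ℝ) (k : ℕ) (a b : Fin k → Fin d) :
    meanTensorPower p k a b = ∑ σ : Equiv.Perm (Fin k), if b ∘ σ = a then
      ∑ r : Fin k → Fin d, if r ∘ σ = r then ∏ i, ((p (r i) / d : ℝ) : ℂ) else 0 else 0 := by
  have h1 : ∀ z : Fin d × Fin d → ℂ, tensorPower (gaussianState p z) k a b =
      ∑ r : Fin k → Fin d, (∏ i, ((p (r i) / d : ℝ) : ℂ)) *
        ∏ i, z (a i, r i) * conj (z (b i, r i)) := by
    intro z
    simp only [tensorPower, gaussianState, Matrix.of_apply]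
    rw [Finset.prod_univ_sum, Fintype.piFinset_univ]
    simp only [Finset.prod_mul_distrib]
  simp only [meanTensorPower, Matrix.of_apply, h1]
  rw [integral_finsetSum]
  · simp only [integral_const_mul]
    simp only [fun r : Fin k → Fin d => integral_wick (I := Fin d × Fin d)
      (fun i => (a i, r i)) (fun i => (b i, r i)), Finset.mul_sum]
    rw [Finset.sum_comm]
    refine Finset.sum_congr rfl fun σ _ => ?_
    by_cases hb : b ∘ σ = a
    · rw [if_pos hb]
      refine Finset.sum_congr rfl fun r _ => ?_
      have : ((fun i => (b i, r i)) ∘ σ = fun i => (a i, r i)) ↔ r ∘ σ = r := by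
        rw [funext_iff, funext_iff]
        refine forall_congr' fun i => ?_
        simp only [Function.comp_apply, Prod.mk.injEq, and_iff_right_iff_imp]
        exact fun _ => congrFun hb i
      simp only [this, mul_ite, mul_one, mul_zero]
    · rw [if_neg hb]
      refine Finset.sum_eq_zero fun r _ => ?_
      rw [if_neg, mul_zero]
      intro h
      exact hb (funext fun i => (Prod.mk.inj (congrFun h i)).1)
  · exact fun r _ => IsMixedPolynomial.integrable (.mul (.const _)
      (.prod fun _ => .mul (.var _) (.conj_var _)))

lemma meanTensorPower_eq_of_powerSum_eq {p q : Fin d → ℝ} {k : ℕ}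
    (h : ∀ i ∈ Finset.Icc 1 k, ∑ r, p r ^ i = ∑ r, q r ^ i) :
    meanTensorPower p k = meanTensorPower q k := by
  ext a b
  rw [meanTensorPower_apply, meanTensorPower_apply]
  refine Finset.sum_congr rfl fun σ _ => ?_
  rw [sum_invariant_eq_of_powerSum_eq σ (w := fun r => ((p r / d : ℝ) : ℂ))
    (w' := fun r => ((q r / d : ℝ) : ℂ))]
  intro i hi
  rw [Fintype.card_fin] at hi
  have := h i hi
  simp only [← Complex.ofReal_pow, ← Complex.ofReal_sum, div_pow, ← Finset.sum_div, this]

end GaussianState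

/-! ### Positivity and monotonicity of tensor powers. -/

open scoped MatrixOrder Matrix.Norms.L2Operator in
lemma exists_eq_conjTranspose_mul_self {ι : Type} [Fintype ι] [DecidableEq ι] {A : Matrix ι ι ℂ}
    (hA : A.PosSemidef) : ∃ B : Matrix ι ι ℂ, A = B.conjTranspose * B :=
  CStarAlgebra.nonneg_iff_eq_star_mul_self.mp hA.nonneg

section Tensor

variable {d k : ℕ}

lemma tensorPower_mul (A B : Matrix (Fin d) (Fin d) ℂ) (k : ℕ) :
    tensorPower (A * B) k = tensorPower A k * tensorPower B k := by
  ext a b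
  simp only [tensorPower, Matrix.of_apply, Matrix.mul_apply]
  rw [Finset.prod_univ_sum, Fintype.piFinset_univ]
  simp only [Finset.prod_mul_distrib]

lemma tensorPower_conjTranspose (A : Matrix (Fin d) (Fin d) ℂ) (k : ℕ) :
    tensorPower A.conjTranspose k = (tensorPower A k).conjTranspose := by
  ext a b
  simp [tensorPower, Matrix.conjTranspose_apply]

lemma trace_tensorPower (A : Matrix (Fin d) (Fin d) ℂ) (k : ℕ) :
    (tensorPower A k).trace = A.trace ^ k := by
  simp only [Matrix.trace, tensorPower, Matrix.of_apply, Matrix.diag_apply]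
  have := Finset.prod_univ_sum (fun _ : Fin k => Finset.univ) (fun _ j => A j j)
  rw [Fintype.piFinset_univ] at this
  rw [← this]
  simp

lemma tensorPower_smul (c : ℂ) (A : Matrix (Fin d) (Fin d) ℂ) (k : ℕ) :
    tensorPower (c • A) k = c ^ k • tensorPower A k := by
  ext a b
  simp [tensorPower, Finset.prod_mul_distrib]

lemma posSemidef_of_prod {D : Fin k → Matrix (Fin d) (Fin d) ℂ} (h : ∀ i, (D i).PosSemidef) :
    (Matrix.of fun a b : Fin k → Fin d => ∏ i, D i (a i) (b i)).PosSemidef := by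
  choose B hB using fun i => exists_eq_conjTranspose_mul_self (h i)
  suffices hmul : (Matrix.of fun a b : Fin k → Fin d => ∏ i, D i (a i) (b i)) =
      (Matrix.of fun a b : Fin k → Fin d => ∏ i, B i (a i) (b i)).conjTranspose *
        Matrix.of fun a b : Fin k → Fin d => ∏ i, B i (a i) (b i) by
    rw [hmul]; exact Matrix.posSemidef_conjTranspose_mul_self _
  ext a b
  simp only [Matrix.mul_apply, Matrix.conjTranspose_apply, Matrix.of_apply, hB, star_prod]
  rw [Finset.prod_univ_sum, Fintype.piFinset_univ]
  simp only [Finset.prod_mul_distrib]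

lemma posSemidef_tensorPower {ρ : Matrix (Fin d) (Fin d) ℂ} (h : ρ.PosSemidef) (k : ℕ) :
    (tensorPower ρ k).PosSemidef :=
  posSemidef_of_prod fun _ => h

/-- Writing `σ = ρ + (σ - ρ)` and expanding over subsets of the tensor factors, the empty subset
gives `ρ^{⊗ k}` and every other term is a tensor product of positive semidefinite matrices. -/
lemma posSemidef_tensorPower_sub {ρ σ : Matrix (Fin d) (Fin d) ℂ} (h : ρ.PosSemidef)
    (hs : (σ - ρ).PosSemidef) (k : ℕ) : (tensorPower σ k - tensorPower ρ k).PosSemidef := by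
  have h1 : tensorPower σ k - tensorPower ρ k =
      ∑ s ∈ (Finset.univ : Finset (Fin k)).powerset.erase ∅,
        Matrix.of fun a b : Fin k → Fin d =>
          ∏ i, (if i ∈ s then σ - ρ else ρ) (a i) (b i) := by
    rw [Finset.sum_erase_eq_sub (Finset.empty_mem_powerset _)]
    congr 1
    · ext a b
      simp only [tensorPower, Matrix.of_apply, Matrix.sum_apply]
      have := Finset.prod_add (fun i => (σ - ρ) (a i) (b i)) (fun i => ρ (a i) (b i))
        (Finset.univ : Finset (Fin k))
      simp only [Matrix.sub_apply, sub_add_cancel] at this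
      rw [this]
      refine Finset.sum_congr rfl fun s hs => ?_
      rw [← Finset.prod_sdiff (Finset.subset_univ s), mul_comm]
      congr 1
      · exact Finset.prod_congr rfl fun i hi => by
          rw [if_neg (Finset.mem_sdiff.1 hi).2]
      · exact Finset.prod_congr rfl fun i hi => by rw [if_pos hi]; rfl
  rw [h1]
  refine Matrix.posSemidef_sum _ fun s _ => posSemidef_of_prod fun i => ?_
  split_ifs
  · exact hs
  · exact h

lemma trace_mul_re_nonneg {ι : Type} [Fintype ι] [DecidableEq ι] {A B : Matrix ι ι ℂ}
    (hA : A.PosSemidef) (hB : B.PosSemidef) : 0 ≤ (A * B).trace.re := by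
  obtain ⟨C, rfl⟩ := exists_eq_conjTranspose_mul_self hA
  rw [Matrix.mul_assoc, Matrix.trace_mul_comm]
  exact (Complex.nonneg_iff.1 (hB.mul_mul_conjTranspose_same C).trace_nonneg).1

end Tensor

/-! ### Outcome weights of adaptive protocols. -/

namespace ReplicaProtocol

variable {S : Type} [Fintype S] {d k T : ℕ}

/-- Total mass of the outcomes of an adaptive scheme whose rounds have total mass `c`. -/
lemma sum_prod_adaptive (T : ℕ) (c : ℝ) (f : (t : Fin T) → (Fin t → S) → S → ℝ)
    (hf : ∀ t h, ∑ s, f t h s = c) :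
    ∑ s : Fin T → S, ∏ t : Fin T, f t (fun i => s (Fin.castLE t.isLt.le i)) (s t) = c ^ T := by
  induction T with
  | zero => simp
  | succ T ih =>
    -- The last outcome is summed out first, since no POVM depends on it.
    rw [← (Fin.snocEquiv fun _ : Fin (T + 1) => S).sum_comp, Fintype.sum_prod_type_right]
    have h1 := ih (fun t => f t.castSucc) (fun t => hf t.castSucc)
    rw [pow_succ, ← h1, Finset.sum_mul]
    refine Finset.sum_congr rfl fun s _ => ?_
    simp only [Fin.prod_univ_castSucc, Fin.snocEquiv, Equiv.coe_fn_mk]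
    rw [← hf (Fin.last T) s, Finset.mul_sum]
    refine Finset.sum_congr rfl fun x _ => ?_
    congr 1
    · refine Finset.prod_congr rfl fun t _ => ?_
      have e1 : Fin.snoc (α := fun _ => S) s x t.castSucc = s t := Fin.snoc_castSucc _ _ _
      rw [e1]
      congr 1
      funext i
      exact Fin.snoc_castSucc (α := fun _ => S) x s (Fin.castLE t.isLt.le i)
    · have e1 : Fin.snoc (α := fun _ => S) s x (Fin.last T) = x := Fin.snoc_last _ _
      rw [e1]
      congr 1
      funext i
      exact Fin.snoc_castSucc (α := fun _ => S) x s i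

/-- The product of the outcome weights in all rounds when each round measures `Ω`. -/
noncomputable def outcomeWeight (P : ReplicaProtocol S d k T)
    (Ω : Matrix (Fin k → Fin d) (Fin k → Fin d) ℂ) (s : Fin T → S) : ℝ :=
  ∏ t : Fin T, (P.povm t (fun i => s (Fin.castLE t.isLt.le i)) (s t) * Ω).trace.re

lemma sum_outcomeWeight (P : ReplicaProtocol S d k T)
    (Ω : Matrix (Fin k → Fin d) (Fin k → Fin d) ℂ) :
    ∑ s, P.outcomeWeight Ω s = Ω.trace.re ^ T := by
  refine sum_prod_adaptive T _ (fun t h x => (P.povm t h x * Ω).trace.re) fun t h => ?_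
  rw [← Complex.re_sum, ← Matrix.trace_sum, ← Finset.sum_mul, (P.isPOVM t h).2, Matrix.one_mul]

lemma sum_outcomeProb (P : ReplicaProtocol S d k T) (ρ : Matrix (Fin d) (Fin d) ℂ) :
    ∑ s, P.outcomeProb ρ s = ((ρ.trace ^ k).re) ^ T := by
  rw [← trace_tensorPower]
  exact P.sum_outcomeWeight _

lemma outcomeProb_nonneg (P : ReplicaProtocol S d k T) {ρ : Matrix (Fin d) (Fin d) ℂ}
    (h : ρ.PosSemidef) (s : Fin T → S) : 0 ≤ P.outcomeProb ρ s :=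
  Finset.prod_nonneg fun _ _ =>
    trace_mul_re_nonneg ((P.isPOVM _ _).1 _) (posSemidef_tensorPower h k)

lemma outcomeProb_mono (P : ReplicaProtocol S d k T) {ρ σ : Matrix (Fin d) (Fin d) ℂ}
    (h : ρ.PosSemidef) (hs : (σ - ρ).PosSemidef) (s : Fin T → S) :
    P.outcomeProb ρ s ≤ P.outcomeProb σ s := by
  refine Finset.prod_le_prod (fun _ _ => trace_mul_re_nonneg ((P.isPOVM _ _).1 _)
    (posSemidef_tensorPower h k)) fun t _ => ?_
  have := trace_mul_re_nonneg ((P.isPOVM t (fun i => s (Fin.castLE t.isLt.le i))).1 (s t))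
    (posSemidef_tensorPower_sub h hs k)
  rw [Matrix.mul_sub, Matrix.trace_sub, Complex.sub_re] at this
  linarith

lemma outcomeProb_smul (P : ReplicaProtocol S d k T) (c : ℝ) (ρ : Matrix (Fin d) (Fin d) ℂ)
    (s : Fin T → S) : P.outcomeProb ((c : ℂ) • ρ) s = c ^ (k * T) * P.outcomeProb ρ s := by
  simp only [outcomeProb, tensorPower_smul, Matrix.mul_smul, Matrix.trace_smul, smul_eq_mul,
    ← Complex.ofReal_pow, Complex.re_ofReal_mul, Finset.prod_mul_distrib]
  simp [pow_mul]

lemma probFirst_add_probSecond (P : ReplicaProtocol S d k T) {ρ : Matrix (Fin d) (Fin d) ℂ}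
    (h : IsState ρ) : P.probFirst ρ + P.probSecond ρ = 1 := by
  rw [probFirst, probSecond, ← Finset.sum_add_distrib]
  simp only [← mul_add, add_sub_cancel, mul_one]
  rw [sum_outcomeProb, h.2]; simp

end ReplicaProtocol

/-! ### Comparison of a persistent random state with independent ones. -/

section LowerBound

variable {d : ℕ}

/-- The square root factor of `gaussianState p z`. -/
noncomputable def gaussianFactor (p : Fin d → ℝ) (z : Fin d × Fin d → ℂ) :
    Matrix (Fin d) (Fin d) ℂ :=
  Matrix.of fun i r => (Real.sqrt (p r / d) : ℂ) * z (i, r)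

lemma gaussianState_eq_mul {p : Fin d → ℝ} (hp : ∀ r, 0 ≤ p r) (z : Fin d × Fin d → ℂ) :
    gaussianState p z = gaussianFactor p z * (gaussianFactor p z).conjTranspose := by
  ext i j
  simp only [gaussianState, gaussianFactor, Matrix.mul_apply, Matrix.of_apply,
    Matrix.conjTranspose_apply]
  refine Finset.sum_congr rfl fun r _ => ?_
  have h : ((p r / d : ℝ) : ℂ) = (Real.sqrt (p r / d) : ℂ) * (Real.sqrt (p r / d) : ℂ) := by
    rw [← Complex.ofReal_mul, Real.mul_self_sqrt (div_nonneg (hp r) (Nat.cast_nonneg d))]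
  rw [h, star_mul']
  simp only [Complex.star_def, Complex.conj_ofReal]
  ring

lemma posSemidef_gaussianState {p : Fin d → ℝ} (hp : ∀ r, 0 ≤ p r) (z : Fin d × Fin d → ℂ) :
    (gaussianState p z).PosSemidef := by
  rw [gaussianState_eq_mul hp]
  exact Matrix.posSemidef_self_mul_conjTranspose _

/-- The entries of `B * (gaussianFactor p z)^{⊗ k}` as polynomials in `z`. -/
noncomputable def amplitudePolynomial {J : Type} (p : Fin d → ℝ) {k : ℕ}
    (B : Matrix J (Fin k → Fin d) ℂ) (j : J) (r : Fin k → Fin d) :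
    MvPolynomial (Fin d × Fin d) ℂ :=
  ∑ x : Fin k → Fin d, MvPolynomial.C (B j x * ∏ i, (Real.sqrt (p (r i) / d) : ℂ)) *
    ∏ i, MvPolynomial.X (x i, r i)

lemma isHomogeneous_amplitudePolynomial {J : Type} (p : Fin d → ℝ) {k : ℕ}
    (B : Matrix J (Fin k → Fin d) ℂ) (j : J) (r : Fin k → Fin d) :
    (amplitudePolynomial p B j r).IsHomogeneous k := by
  refine MvPolynomial.IsHomogeneous.sum _ _ _ fun x _ => ?_
  have h := (MvPolynomial.isHomogeneous_C (Fin d × Fin d)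
    (B j x * ∏ i, (Real.sqrt (p (r i) / d) : ℂ))).mul
    (MvPolynomial.IsHomogeneous.prod Finset.univ
      (fun i : Fin k => (MvPolynomial.X (x i, r i) : MvPolynomial (Fin d × Fin d) ℂ))
      (fun _ => 1) fun i _ => MvPolynomial.isHomogeneous_X _ _)
  simpa using h

lemma eval_amplitudePolynomial {J : Type} (p : Fin d → ℝ) {k : ℕ}
    (B : Matrix J (Fin k → Fin d) ℂ) (j : J) (r : Fin k → Fin d) (z : Fin d × Fin d → ℂ) :
    MvPolynomial.eval z (amplitudePolynomial p B j r) =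
      (B * tensorPower (gaussianFactor p z) k) j r := by
  simp only [amplitudePolynomial, map_sum, map_mul, MvPolynomial.eval_C, map_prod,
    MvPolynomial.eval_X, Matrix.mul_apply, tensorPower, gaussianFactor, Matrix.of_apply,
    Finset.prod_mul_distrib, mul_assoc]

lemma trace_mul_conjTranspose_re {J K : Type} [Fintype J] [Fintype K] (M : Matrix J K ℂ) :
    (M * M.conjTranspose).trace.re = ∑ j, ∑ r, ‖M j r‖ ^ 2 := by
  simp only [Matrix.trace, Matrix.diag_apply, Matrix.mul_apply, Matrix.conjTranspose_apply,
    Complex.re_sum, Complex.star_def, Complex.mul_conj, Complex.ofReal_re,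
    Complex.normSq_eq_norm_sq]

/-- With the state written as `A * Aᴴ`, the trace is the squared Frobenius norm of `B * A^{⊗ k}`.
Its entries involve `z` but not its conjugate, which is the form that Bombieri's inequality needs.
-/
lemma trace_mul_tensorPower_gaussianState {p : Fin d → ℝ} (hp : ∀ r, 0 ≤ p r) {k : ℕ}
    (B : Matrix (Fin k → Fin d) (Fin k → Fin d) ℂ) (z : Fin d × Fin d → ℂ) :
    (B.conjTranspose * B * tensorPower (gaussianState p z) k).trace.re =
      ∑ w : (Fin k → Fin d) × (Fin k → Fin d),
        ‖MvPolynomial.eval z (amplitudePolynomial p B w.1 w.2)‖ ^ 2 := by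
  rw [gaussianState_eq_mul hp, tensorPower_mul, tensorPower_conjTranspose, Matrix.mul_assoc,
    Matrix.trace_mul_comm]
  have : B * (tensorPower (gaussianFactor p z) k *
      (tensorPower (gaussianFactor p z) k).conjTranspose) * B.conjTranspose =
      (B * tensorPower (gaussianFactor p z) k) *
        (B * tensorPower (gaussianFactor p z) k).conjTranspose := by
    rw [Matrix.conjTranspose_mul]; simp only [Matrix.mul_assoc]
  rw [this, trace_mul_conjTranspose_re, Fintype.sum_prod_type]
  simp only [eval_amplitudePolynomial]

lemma integral_trace_mul_tensorPower (p : Fin d → ℝ) {k : ℕ}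
    (F : Matrix (Fin k → Fin d) (Fin k → Fin d) ℂ) :
    ∫ z, (F * tensorPower (gaussianState p z) k).trace.re ∂(gaussianFamily _) =
      (F * meanTensorPower p k).trace.re := by
  have hm : ∀ a b, IsMixedPolynomial fun z => F a b * tensorPower (gaussianState p z) k b a :=
    fun a b => .mul (.const _) (isMixedPolynomial_tensorPower p k b a)
  have h1 : ∫ z, (F * tensorPower (gaussianState p z) k).trace ∂(gaussianFamily _) =
      (F * meanTensorPower p k).trace := by
    simp only [Matrix.trace, Matrix.diag_apply, Matrix.mul_apply]
    rw [integral_finsetSum _ fun a _ => (IsMixedPolynomial.sum fun b => hm a b).integrable]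
    refine Finset.sum_congr rfl fun a _ => ?_
    rw [integral_finsetSum _ fun b _ => (hm a b).integrable]
    refine Finset.sum_congr rfl fun b _ => ?_
    rw [integral_const_mul]; rfl
  rw [← h1]
  refine integral_re (𝕜 := ℂ) (IsMixedPolynomial.integrable ?_)
  simp only [Matrix.trace, Matrix.diag_apply, Matrix.mul_apply]
  exact .sum fun a => .sum fun b => hm a b

lemma prod_sum_norm_sq_eq {W : Type} [Fintype W] {T : ℕ}
    (P : Fin T → W → MvPolynomial (Fin d × Fin d) ℂ) (z : Fin d × Fin d → ℂ) :
    ∏ t, ∑ w, ‖MvPolynomial.eval z (P t w)‖ ^ 2 =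
      ∑ w : Fin T → W, ‖MvPolynomial.eval z (∏ t, P t (w t))‖ ^ 2 := by
  rw [Finset.prod_univ_sum, Fintype.piFinset_univ]
  simp only [map_prod, norm_prod, Finset.prod_pow]

/-- Measuring the same random state in all rounds makes every sequence of outcomes at least as
likely as measuring independent copies. -/
theorem prod_trace_meanTensorPower_le {p : Fin d → ℝ} (hp : ∀ r, 0 ≤ p r) {k T : ℕ}
    (F : Fin T → Matrix (Fin k → Fin d) (Fin k → Fin d) ℂ) (hF : ∀ t, (F t).PosSemidef) :
    Integrable (fun z => ∏ t, (F t * tensorPower (gaussianState p z) k).trace.re)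
      (gaussianFamily _) ∧
    ∏ t, (F t * meanTensorPower p k).trace.re ≤
      ∫ z, ∏ t, (F t * tensorPower (gaussianState p z) k).trace.re ∂(gaussianFamily _) := by
  choose B hB using fun t => exists_eq_conjTranspose_mul_self (hF t)
  have hX : ∀ t z, (F t * tensorPower (gaussianState p z) k).trace.re =
      ∑ w : (Fin k → Fin d) × (Fin k → Fin d),
        ‖MvPolynomial.eval z (amplitudePolynomial p (B t) w.1 w.2)‖ ^ 2 := fun t z => by
    rw [hB t]; exact trace_mul_tensorPower_gaussianState hp (B t) z
  have hΩ : ∀ t, (F t * meanTensorPower p k).trace.re =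
      ∑ w : (Fin k → Fin d) × (Fin k → Fin d),
        gaussianNormSq (amplitudePolynomial p (B t) w.1 w.2) := fun t => by
    rw [← integral_trace_mul_tensorPower]
    simp only [hX]
    exact integral_finsetSum _ fun w _ => integrable_norm_eval_sq _
  simp only [hX, hΩ, prod_sum_norm_sq_eq (fun t (w : (Fin k → Fin d) × (Fin k → Fin d)) =>
    amplitudePolynomial p (B t) w.1 w.2)]
  refine ⟨integrable_finsetSum _ fun w _ => integrable_norm_eval_sq _, ?_⟩
  rw [integral_finsetSum _ fun w _ => integrable_norm_eval_sq _, Finset.prod_univ_sum,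
    Fintype.piFinset_univ]
  exact Finset.sum_le_sum fun w _ => prod_gaussianNormSq_le _ _ fun t _ =>
    isHomogeneous_amplitudePolynomial _ _ _ _

end LowerBound

/-! ### Domination of the random state by a true state of spectrum `p`. -/

section Domination

variable {d : ℕ}

/-- The Gram matrix of the columns of `z`, divided by the dimension. -/
noncomputable def gramMatrix (z : Fin d × Fin d → ℂ) : Matrix (Fin d) (Fin d) ℂ :=
  Matrix.of fun i j => (d : ℂ)⁻¹ * ∑ a, conj (z (a, i)) * z (a, j)

/-- Squared Frobenius distance of the Gram matrix to the identity on the columns in `s`. -/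
noncomputable def gramDeviation (s : Finset (Fin d)) (z : Fin d × Fin d → ℂ) : ℝ :=
  ∑ i ∈ s, ∑ j ∈ s, ‖gramMatrix z i j - if i = j then 1 else 0‖ ^ 2

lemma gramDeviation_nonneg (s : Finset (Fin d)) (z : Fin d × Fin d → ℂ) :
    0 ≤ gramDeviation s z :=
  Finset.sum_nonneg fun _ _ => Finset.sum_nonneg fun _ _ => by positivity

/-- Cauchy–Schwarz: the Frobenius norm bounds the operator norm. -/
lemma norm_sum_mul_le {ι : Type} (s : Finset ι) (M : ι → ι → ℂ) (y : ι → ℂ) {ε : ℝ} (hε : 0 ≤ ε)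
    (h : ∑ i ∈ s, ∑ j ∈ s, ‖M i j‖ ^ 2 ≤ ε ^ 2) :
    ‖∑ i ∈ s, ∑ j ∈ s, conj (y i) * M i j * y j‖ ≤ ε * ∑ i ∈ s, ‖y i‖ ^ 2 := by
  have h0 : 0 ≤ ∑ i ∈ s, ‖y i‖ ^ 2 := Finset.sum_nonneg fun _ _ => by positivity
  have h1 : ‖∑ i ∈ s, ∑ j ∈ s, conj (y i) * M i j * y j‖ ≤
      ∑ x ∈ s ×ˢ s, ‖M x.1 x.2‖ * (‖y x.1‖ * ‖y x.2‖) := by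
    rw [← Finset.sum_product']
    refine (norm_sum_le _ _).trans (Finset.sum_le_sum fun x _ => le_of_eq ?_)
    rw [norm_mul, norm_mul, RCLike.norm_conj]; ring
  have h2 := Finset.sum_mul_sq_le_sq_mul_sq (s ×ˢ s) (fun x => ‖M x.1 x.2‖)
    (fun x => ‖y x.1‖ * ‖y x.2‖)
  have h3 : ∑ x ∈ s ×ˢ s, (‖y x.1‖ * ‖y x.2‖) ^ 2 = (∑ i ∈ s, ‖y i‖ ^ 2) ^ 2 := by
    rw [sq (∑ i ∈ s, _), Finset.sum_mul_sum, ← Finset.sum_product']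
    exact Finset.sum_congr rfl fun x _ => by ring
  rw [h3, Finset.sum_product (f := fun x => ‖M x.1 x.2‖ ^ 2)] at h2
  refine h1.trans (abs_le_of_sq_le_sq' ?_ (by positivity)).2
  rw [mul_pow]
  exact h2.trans (mul_le_mul_of_nonneg_right h (by positivity))

lemma gaussianFactor_conjTranspose_mul_apply {p : Fin d → ℝ} (hp : ∀ r, 0 ≤ p r)
    (z : Fin d × Fin d → ℂ) (i j : Fin d) :
    ((gaussianFactor p z).conjTranspose * gaussianFactor p z) i j =
      (Real.sqrt (p i) : ℂ) * gramMatrix z i j * (Real.sqrt (p j) : ℂ) := by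
  have hd : (Real.sqrt d : ℂ)⁻¹ * (Real.sqrt d : ℂ)⁻¹ = (d : ℂ)⁻¹ := by
    rw [← mul_inv, ← Complex.ofReal_mul, Real.mul_self_sqrt (Nat.cast_nonneg d),
      Complex.ofReal_natCast]
  simp only [Matrix.mul_apply, Matrix.conjTranspose_apply, gaussianFactor, gramMatrix,
    Matrix.of_apply, Real.sqrt_div (hp _), Complex.ofReal_div, ← hd]
  simp only [Finset.mul_sum, Finset.sum_mul]
  refine Finset.sum_congr rfl fun a _ => ?_
  simp only [star_mul', Complex.star_def, Complex.conj_ofReal, div_eq_mul_inv, map_inv₀]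
  ring

/-- In terms of `y = √p x` the quadratic form is `ε ‖y‖² - ⟨y, (G - 1) y⟩`, with `G` the Gram
matrix. Since `p` vanishes off `s`, so does `y`, and only the columns in `s` need to be nearly
orthonormal. -/
lemma posSemidef_diagonal_sub {p : Fin d → ℝ} (hp : ∀ r, 0 ≤ p r) {s : Finset (Fin d)}
    (hs : ∀ r, r ∉ s → p r = 0) {z : Fin d × Fin d → ℂ} {ε : ℝ} (hε : 0 ≤ ε)
    (h : gramDeviation s z ≤ ε ^ 2) :
    ((((1 + ε : ℝ) : ℂ) • Matrix.diagonal fun r => (p r : ℂ)) -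
      (gaussianFactor p z).conjTranspose * gaussianFactor p z).PosSemidef := by
  set A := gaussianFactor p z
  have hH : ((((1 + ε : ℝ) : ℂ) • Matrix.diagonal fun r => (p r : ℂ)) -
      A.conjTranspose * A).IsHermitian := by
    refine Matrix.IsHermitian.sub ?_ (Matrix.isHermitian_conjTranspose_mul_self A)
    rw [Matrix.IsHermitian, Matrix.conjTranspose_smul, Matrix.diagonal_conjTranspose]
    congr 1
    · exact Complex.conj_ofReal _
    · congr 1; funext r; exact Complex.conj_ofReal _
  refine Matrix.PosSemidef.of_dotProduct_mulVec_nonneg hH fun x => ?_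
  set y : Fin d → ℂ := fun r => (Real.sqrt (p r) : ℂ) * x r with hy
  have hy0 : ∀ r, r ∉ s → y r = 0 := fun r hr => by simp [hy, hs r hr]
  have e1 : star x ⬝ᵥ ((((1 + ε : ℝ) : ℂ) • Matrix.diagonal fun r => (p r : ℂ)) -
      A.conjTranspose * A).mulVec x =
      ((ε * ∑ i ∈ s, ‖y i‖ ^ 2 : ℝ) : ℂ) - ∑ i ∈ s, ∑ j ∈ s,
        conj (y i) * (gramMatrix z i j - if i = j then 1 else 0) * y j := by
    have s1 : ∀ f : Fin d → ℂ, (∀ r, r ∉ s → f r = 0) → ∑ i ∈ s, f i = ∑ i, f i :=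
      fun f hf => Finset.sum_subset (Finset.subset_univ s) fun r _ hr => hf r hr
    have e2 : ∑ i ∈ s, ∑ j ∈ s, conj (y i) * (gramMatrix z i j - if i = j then 1 else 0) * y j =
        ∑ i, ∑ j, conj (y i) * (gramMatrix z i j - if i = j then 1 else 0) * y j := by
      rw [s1 _ fun r hr => by simp [hy0 r hr]]
      exact Finset.sum_congr rfl fun i _ => s1 _ fun r hr => by simp [hy0 r hr]
    have e3 : ((ε * ∑ i ∈ s, ‖y i‖ ^ 2 : ℝ) : ℂ) = ε * ∑ i, conj (y i) * y i := by
      push_cast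
      rw [← s1 _ fun r hr => by simp [hy0 r hr]]
      congr 1
      refine Finset.sum_congr rfl fun i _ => ?_
      rw [mul_comm, Complex.mul_conj, Complex.normSq_eq_norm_sq]; push_cast; rfl
    have hsq : ∀ i, ((p i : ℝ) : ℂ) = (Real.sqrt (p i) : ℂ) * (Real.sqrt (p i) : ℂ) := fun i => by
      rw [← Complex.ofReal_mul, Real.mul_self_sqrt (hp i)]
    rw [e2, e3, Matrix.sub_mulVec, dotProduct_sub, Matrix.smul_mulVec, dotProduct_smul]
    have e4 : star x ⬝ᵥ (Matrix.diagonal fun r => (p r : ℂ)).mulVec x =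
        ∑ i, conj (y i) * y i := by
      simp only [dotProduct, Matrix.mulVec_diagonal, Pi.star_apply, Complex.star_def, hy, map_mul,
        Complex.conj_ofReal, hsq]
      exact Finset.sum_congr rfl fun i _ => by ring
    have e5 : star x ⬝ᵥ (A.conjTranspose * A).mulVec x =
        ∑ i, ∑ j, conj (y i) * gramMatrix z i j * y j := by
      simp only [dotProduct, Matrix.mulVec, Pi.star_apply, Complex.star_def, hy, map_mul,
        Complex.conj_ofReal, A, gaussianFactor_conjTranspose_mul_apply hp, Finset.mul_sum]
      exact Finset.sum_congr rfl fun i _ => Finset.sum_congr rfl fun j _ => by ring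
    rw [e4, e5]
    simp only [mul_sub, sub_mul, Finset.sum_sub_distrib, mul_ite, ite_mul, mul_one, mul_zero,
      zero_mul, Finset.sum_ite_eq, Finset.mem_univ, if_true]
    push_cast
    simp only [smul_eq_mul]
    ring
  have him := hH.im_star_dotProduct_mulVec_self x
  rw [Complex.nonneg_iff]
  refine ⟨?_, him.symm⟩
  rw [e1, Complex.sub_re, Complex.ofReal_re]
  have h2 := norm_sum_mul_le s (fun i j => gramMatrix z i j - if i = j then 1 else 0) y hε h
  linarith [Complex.re_le_norm (∑ i ∈ s, ∑ j ∈ s,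
        conj (y i) * (gramMatrix z i j - if i = j then 1 else 0) * y j)]

lemma hasSpectrum_conj_diagonal {V : Matrix (Fin d) (Fin d) ℂ} (hV : V.conjTranspose * V = 1)
    (p : Fin d → ℝ) :
    HasSpectrum (V * (Matrix.diagonal fun r => (p r : ℂ)) * V.conjTranspose) p := by
  have hD : (Matrix.diagonal fun r => (p r : ℂ)).IsHermitian := by
    rw [Matrix.IsHermitian, Matrix.diagonal_conjTranspose]
    congr 1; funext r; exact Complex.conj_ofReal _
  have hH := Matrix.isHermitian_mul_mul_conjTranspose V hD
  refine ⟨hH, ?_⟩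
  have h1 := hH.roots_charpoly_eq_eigenvalues
  rw [Matrix.charpoly_mul_comm, ← Matrix.mul_assoc, hV, Matrix.one_mul, Matrix.charpoly_diagonal,
    Polynomial.roots_prod _ _ (Finset.prod_ne_zero_iff.2 fun i _ =>
      Polynomial.X_sub_C_ne_zero _)] at h1
  simp only [Polynomial.roots_X_sub_C, Multiset.bind_singleton] at h1
  refine Multiset.map_injective Complex.ofReal_injective ?_
  rw [Multiset.map_map, Multiset.map_map]
  exact h1.symm

lemma isState_conj_diagonal {V : Matrix (Fin d) (Fin d) ℂ} (hV : V.conjTranspose * V = 1)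
    {p : Fin d → ℝ} (hp : p ∈ stdSimplex ℝ (Fin d)) :
    IsState (V * (Matrix.diagonal fun r => (p r : ℂ)) * V.conjTranspose) := by
  refine ⟨Matrix.PosSemidef.mul_mul_conjTranspose_same (Matrix.PosSemidef.diagonal fun r => ?_) V,
    ?_⟩
  · exact Complex.zero_le_real.2 (hp.1 r)
  · rw [Matrix.trace_mul_comm, ← Matrix.mul_assoc, hV, Matrix.one_mul, Matrix.trace_diagonal,
      ← Complex.ofReal_sum, hp.2, Complex.ofReal_one]

/-- `A * Aᴴ` and `Aᴴ * A` are unitarily equivalent. -/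
lemma exists_unitary_mul_conjTranspose_eq (A : Matrix (Fin d) (Fin d) ℂ) :
    ∃ V : Matrix (Fin d) (Fin d) ℂ, V.conjTranspose * V = 1 ∧
      A * A.conjTranspose = V * (A.conjTranspose * A) * V.conjTranspose := by
  have h1 := Matrix.isHermitian_mul_conjTranspose_self A
  have h2 := Matrix.isHermitian_conjTranspose_mul_self A
  have he : h1.eigenvalues = h2.eigenvalues :=
    (Matrix.IsHermitian.eigenvalues_eq_eigenvalues_iff h1 h2).2 (Matrix.charpoly_mul_comm _ _)
  have s1 := h1.spectral_theorem
  have s2 := h2.spectral_theorem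
  rw [Unitary.conjStarAlgAut_apply] at s1 s2
  set U₁ : Matrix (Fin d) (Fin d) ℂ := h1.eigenvectorUnitary.1
  set U₂ : Matrix (Fin d) (Fin d) ℂ := h2.eigenvectorUnitary.1
  have u1 : U₁.conjTranspose * U₁ = 1 := Unitary.coe_star_mul_self h1.eigenvectorUnitary
  have u2 : U₂.conjTranspose * U₂ = 1 := Unitary.coe_star_mul_self h2.eigenvectorUnitary
  have u2' : U₂ * U₂.conjTranspose = 1 := Unitary.coe_mul_star_self h2.eigenvectorUnitary
  rw [he] at s1
  set D : Matrix (Fin d) (Fin d) ℂ := Matrix.diagonal (RCLike.ofReal ∘ h2.eigenvalues)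
  have s1' : A * A.conjTranspose = U₁ * D * U₁.conjTranspose := s1
  have s2' : A.conjTranspose * A = U₂ * D * U₂.conjTranspose := s2
  refine ⟨U₁ * U₂.conjTranspose, ?_, ?_⟩
  · rw [Matrix.conjTranspose_mul, Matrix.conjTranspose_conjTranspose, Matrix.mul_assoc,
      ← Matrix.mul_assoc U₁.conjTranspose, u1, Matrix.one_mul, u2']
  · rw [s1', s2', Matrix.conjTranspose_mul, Matrix.conjTranspose_conjTranspose]
    calc U₁ * D * U₁.conjTranspose
        = U₁ * (U₂.conjTranspose * U₂) * D * (U₂.conjTranspose * U₂) * U₁.conjTranspose := by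
          rw [u2, Matrix.mul_one, Matrix.mul_one]
      _ = _ := by simp only [Matrix.mul_assoc]

/-- When the columns of `z` are nearly orthonormal, `gaussianState p z` is dominated by a state
with spectrum `p`. -/
theorem exists_state_dominating {p : Fin d → ℝ} (hp : p ∈ stdSimplex ℝ (Fin d))
    {s : Finset (Fin d)} (hs : ∀ r, r ∉ s → p r = 0) {z : Fin d × Fin d → ℂ} {ε : ℝ}
    (hε : 0 ≤ ε) (h : gramDeviation s z ≤ ε ^ 2) :
    ∃ ρ, IsState ρ ∧ HasSpectrum ρ p ∧
      (((1 + ε : ℝ) : ℂ) • ρ - gaussianState p z).PosSemidef := by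
  obtain ⟨V, hV, hA⟩ := exists_unitary_mul_conjTranspose_eq (gaussianFactor p z)
  refine ⟨_, isState_conj_diagonal hV hp, hasSpectrum_conj_diagonal hV p, ?_⟩
  have := (posSemidef_diagonal_sub hp.1 hs hε h).mul_mul_conjTranspose_same V
  rw [Matrix.mul_sub, Matrix.sub_mul, ← hA, ← gaussianState_eq_mul hp.1, Matrix.mul_smul,
    Matrix.smul_mul] at this
  exact this

/-- The trace of `gaussianState p z`. -/
noncomputable def gaussianTrace (p : Fin d → ℝ) (z : Fin d × Fin d → ℂ) : ℝ :=
  ∑ x : Fin d × Fin d, p x.2 / d * ‖z x‖ ^ 2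

lemma trace_gaussianState (p : Fin d → ℝ) (z : Fin d × Fin d → ℂ) :
    (gaussianState p z).trace = gaussianTrace p z := by
  simp only [Matrix.trace, Matrix.diag_apply, gaussianState, Matrix.of_apply, gaussianTrace,
    Complex.mul_conj, Complex.normSq_eq_norm_sq, Fintype.sum_prod_type]
  push_cast
  rfl

lemma gaussianTrace_nonneg {p : Fin d → ℝ} (hp : ∀ r, 0 ≤ p r) (z : Fin d × Fin d → ℂ) :
    0 ≤ gaussianTrace p z :=
  Finset.sum_nonneg fun x _ => mul_nonneg (div_nonneg (hp _) (Nat.cast_nonneg d)) (by positivity)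

/-- The bound holds for every `z`, so it can be integrated without conditioning. If the Gram
deviation is small, a dominating state gives the first term; otherwise the last two absorb the
trivial bound by a power of the trace. -/
theorem sum_outcomeProb_gaussianState_le {S : Type} [Fintype S] {k T : ℕ}
    (P : ReplicaProtocol S d k T) {p : Fin d → ℝ} (hp : p ∈ stdSimplex ℝ (Fin d))
    {s : Finset (Fin d)} (hs : ∀ r, r ∉ s → p r = 0) {g : (Fin T → S) → ℝ}
    (hg : ∀ x, g x ∈ Set.Icc (0 : ℝ) 1) {η : ℝ} (hη : 0 ≤ η)
    (hP : ∀ ρ, IsState ρ → HasSpectrum ρ p → ∑ x, P.outcomeProb ρ x * g x ≤ η)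
    {ε : ℝ} (hε : 0 < ε) (z : Fin d × Fin d → ℂ) :
    ∑ x, P.outcomeProb (gaussianState p z) x * g x ≤
      (1 + ε) ^ (k * T) * η +
        (1 / 20 * Real.exp ((2 * (k * T) : ℕ) * (gaussianTrace p z - 1)) +
          5 / ε ^ 2 * gramDeviation s z) := by
  have hpsd := posSemidef_gaussianState hp.1 z
  by_cases hF : gramDeviation s z ≤ ε ^ 2
  · obtain ⟨ρ, hρ, hρp, hdom⟩ := exists_state_dominating hp hs hε.le hF
    have h1 : ∑ x, P.outcomeProb (gaussianState p z) x * g x ≤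
        (1 + ε) ^ (k * T) * ∑ x, P.outcomeProb ρ x * g x := by
      rw [Finset.mul_sum]
      refine Finset.sum_le_sum fun x _ => ?_
      rw [← mul_assoc, ← P.outcomeProb_smul]
      exact mul_le_mul_of_nonneg_right (P.outcomeProb_mono hpsd hdom x) (hg x).1
    have h2 : 0 ≤ 5 / ε ^ 2 * gramDeviation s z :=
      mul_nonneg (by positivity) (gramDeviation_nonneg s z)
    have h3 := mul_le_mul_of_nonneg_left (hP ρ hρ hρp)
      (show 0 ≤ (1 + ε) ^ (k * T) by positivity)
    linarith [Real.exp_pos ((2 * (k * T) : ℕ) * (gaussianTrace p z - 1))]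
  · push Not at hF
    set τ := gaussianTrace p z with hτ
    have hτ0 : 0 ≤ τ := gaussianTrace_nonneg hp.1 z
    have h1 : ∑ x, P.outcomeProb (gaussianState p z) x * g x ≤ τ ^ (k * T) := by
      calc _ ≤ ∑ x, P.outcomeProb (gaussianState p z) x :=
            Finset.sum_le_sum fun x _ =>
              mul_le_of_le_one_right (P.outcomeProb_nonneg hpsd x) (hg x).2
        _ = τ ^ (k * T) := by
            rw [P.sum_outcomeProb, trace_gaussianState, ← Complex.ofReal_pow, Complex.ofReal_re,
              pow_mul]
    have h2 : (τ ^ (k * T)) ^ 2 ≤ Real.exp ((2 * (k * T) : ℕ) * (τ - 1)) := by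
      rw [← pow_mul, mul_comm (k * T) 2, Real.exp_nat_mul]
      refine pow_le_pow_left₀ hτ0 ?_ _
      linarith [Real.add_one_le_exp (τ - 1)]
    have h3 : 5 ≤ 5 / ε ^ 2 * gramDeviation s z := by
      rw [div_mul_eq_mul_div, le_div_iff₀ (by positivity)]; linarith
    have h4 : 0 ≤ (1 + ε) ^ (k * T) * η := by positivity
    -- With `n = k * T`, this is `τ ^ n ≤ τ ^ (2 * n) / 20 + 5`; the constant `5` is paid for by the
    -- large deviation.
    nlinarith [sq_nonneg (τ ^ (k * T) - 10)]

end Domination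

/-! ### Mean Gram deviation and exponential moments of the trace. -/

section Expectations

variable {d : ℕ}

lemma integral_mul_conj {I : Type} [Fintype I] [DecidableEq I] (x y : I) :
    ∫ z : I → ℂ, z x * conj (z y) ∂(gaussianFamily I) = if x = y then 1 else 0 := by
  have h := integral_wick (κ := Fin 1) (fun _ => x) (fun _ => y)
  simp only [Fin.prod_univ_one] at h
  rw [h]
  simp [funext_iff, eq_comm]

lemma integral_mul_mul_conj_mul_conj {I : Type} [Fintype I] [DecidableEq I] (x x' y y' : I) :
    ∫ z : I → ℂ, (z x * conj (z y)) * (z x' * conj (z y')) ∂(gaussianFamily I) =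
      (if x = y ∧ x' = y' then 1 else 0) + if x = y' ∧ x' = y then 1 else 0 := by
  have h := integral_wick (κ := Fin 2) ![x, x'] ![y, y']
  simp only [Fin.prod_univ_two, Matrix.cons_val_zero, Matrix.cons_val_one] at h
  rw [h]
  have hu : (Finset.univ : Finset (Equiv.Perm (Fin 2))) = {1, Equiv.swap 0 1} := by decide
  rw [hu, Finset.sum_pair (by decide)]
  simp [funext_iff, Fin.forall_fin_two, eq_comm]

lemma isMixedPolynomial_gramMatrix (i j : Fin d) :
    IsMixedPolynomial fun z => gramMatrix z i j := by
  simp only [gramMatrix, Matrix.of_apply]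
  exact .mul (.const _) (.sum fun _ => .mul (.conj_var _) (.var _))

lemma gramMatrix_conj (z : Fin d × Fin d → ℂ) (i j : Fin d) :
    conj (gramMatrix z i j) = gramMatrix z j i := by
  simp only [gramMatrix, Matrix.of_apply, map_mul, map_inv₀, map_natCast, map_sum,
    Complex.conj_conj]
  congr 1
  exact Finset.sum_congr rfl fun _ _ => mul_comm _ _

lemma integral_gramMatrix (hd : 0 < d) (i j : Fin d) :
    ∫ z, gramMatrix z i j ∂(gaussianFamily _) = if i = j then 1 else 0 := by
  have hd' : (d : ℂ) ≠ 0 := by exact_mod_cast hd.ne'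
  simp only [gramMatrix, Matrix.of_apply, integral_const_mul]
  rw [integral_finsetSum _ fun a _ => IsMixedPolynomial.integrable (.mul (.conj_var _) (.var _))]
  simp only [mul_comm (conj _), integral_mul_conj, Prod.mk.injEq, true_and, Finset.sum_const,
    Finset.card_univ, Fintype.card_fin, nsmul_eq_mul]
  rw [← mul_assoc, inv_mul_cancel₀ hd', one_mul]
  simp only [eq_comm]

/-- Of the two Wick pairings, one needs `i = j` and contributes `1` then; the other needs equal row
indices `a = b` and contributes `d / d ^ 2`. -/
lemma integral_gramMatrix_mul (hd : 0 < d) (i j : Fin d) :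
    ∫ z, gramMatrix z i j * gramMatrix z j i ∂(gaussianFamily _) =
      (if i = j then 1 else 0) + (d : ℂ)⁻¹ := by
  have hd' : (d : ℂ) ≠ 0 := by exact_mod_cast hd.ne'
  have h1 : ∀ z : Fin d × Fin d → ℂ, gramMatrix z i j * gramMatrix z j i =
      ((d : ℂ)⁻¹ * (d : ℂ)⁻¹) * ∑ a, ∑ b,
        (z (a, j) * conj (z (a, i))) * (z (b, i) * conj (z (b, j))) := by
    intro z
    simp only [gramMatrix, Matrix.of_apply, mul_comm (conj _)]
    rw [← Finset.sum_mul_sum]; ring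
  have hi : ∀ a b : Fin d, Integrable (fun z : Fin d × Fin d → ℂ =>
      (z (a, j) * conj (z (a, i))) * (z (b, i) * conj (z (b, j)))) (gaussianFamily _) := fun a b =>
    IsMixedPolynomial.integrable
      (.mul (.mul (.var _) (.conj_var _)) (.mul (.var _) (.conj_var _)))
  simp only [h1, integral_const_mul]
  rw [integral_finsetSum _ fun a _ => integrable_finsetSum _ fun b _ => hi a b]
  simp only [fun a => integral_finsetSum Finset.univ fun b _ => hi a b,
    integral_mul_mul_conj_mul_conj, Prod.mk.injEq, true_and, and_true, Finset.sum_add_distrib]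
  have h2 : ∀ a b : Fin d, (b = a ↔ a = b) := fun _ _ => eq_comm
  simp only [h2, and_self, Finset.sum_ite_eq, Finset.mem_univ, if_true, Finset.sum_const,
    Finset.card_univ, Fintype.card_fin, nsmul_eq_mul, mul_one]
  by_cases hij : i = j
  · simp only [hij, if_true]; field_simp
  · simp only [hij, if_false]; field_simp

lemma norm_gramMatrix_sub_sq (z : Fin d × Fin d → ℂ) (i j : Fin d) :
    ((‖gramMatrix z i j - if i = j then 1 else 0‖ ^ 2 : ℝ) : ℂ) =
      gramMatrix z i j * gramMatrix z j i - (if i = j then 1 else 0) *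
        (gramMatrix z i j + gramMatrix z j i) + if i = j then 1 else 0 := by
  rw [← Complex.normSq_eq_norm_sq, ← Complex.mul_conj, map_sub, gramMatrix_conj]
  split_ifs
  · simp; ring
  · simp

lemma integrable_norm_gramMatrix_sub_sq (i j : Fin d) :
    Integrable (fun z => ‖gramMatrix z i j - if i = j then 1 else 0‖ ^ 2)
      (gaussianFamily (Fin d × Fin d)) := by
  have h : IsMixedPolynomial fun z : Fin d × Fin d → ℂ =>
      ((‖gramMatrix z i j - if i = j then 1 else 0‖ ^ 2 : ℝ) : ℂ) := by
    have h1 : ∀ z : Fin d × Fin d → ℂ,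
        ((‖gramMatrix z i j - if i = j then 1 else 0‖ ^ 2 : ℝ) : ℂ) =
          gramMatrix z i j * gramMatrix z j i + (-(if i = j then 1 else 0)) *
            (gramMatrix z i j + gramMatrix z j i) + if i = j then 1 else 0 := fun z => by
      rw [norm_gramMatrix_sub_sq]; ring
    simp only [h1]
    exact .add (.add (.mul (isMixedPolynomial_gramMatrix _ _) (isMixedPolynomial_gramMatrix _ _))
      (.mul (.const _) (.add (isMixedPolynomial_gramMatrix _ _)
        (isMixedPolynomial_gramMatrix _ _)))) (.const _)
  exact h.integrable.re

lemma integral_norm_gramMatrix_sub_sq (hd : 0 < d) (i j : Fin d) :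
    ∫ z, ‖gramMatrix z i j - if i = j then 1 else 0‖ ^ 2 ∂(gaussianFamily (Fin d × Fin d)) =
      (d : ℝ)⁻¹ := by
  apply Complex.ofReal_injective
  rw [← integral_complex_ofReal]
  simp only [norm_gramMatrix_sub_sq]
  have i1 := (isMixedPolynomial_gramMatrix i j).integrable
  have i2 := (isMixedPolynomial_gramMatrix j i).integrable
  have i3 := ((isMixedPolynomial_gramMatrix i j).mul (isMixedPolynomial_gramMatrix j i)).integrable
  have i4 : Integrable (fun z : Fin d × Fin d → ℂ => (if i = j then (1 : ℂ) else 0) *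
        (gramMatrix z i j + gramMatrix z j i)) (gaussianFamily _) := (i1.add i2).const_mul _
  have i5 : Integrable (fun z : Fin d × Fin d → ℂ => gramMatrix z i j * gramMatrix z j i -
      (if i = j then (1 : ℂ) else 0) * (gramMatrix z i j + gramMatrix z j i))
        (gaussianFamily _) := i3.sub i4
  rw [integral_add i5 (integrable_const _), integral_sub i3 i4, integral_const_mul,
    integral_add i1 i2, integral_gramMatrix_mul hd, integral_gramMatrix hd, integral_gramMatrix hd,
    integral_const]
  by_cases hij : i = j
  · simp only [hij, if_true]; simp
  · simp [hij]

lemma integrable_gramDeviation (s : Finset (Fin d)) :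
    Integrable (gramDeviation s) (gaussianFamily (Fin d × Fin d)) :=
  integrable_finsetSum _ fun i _ => integrable_finsetSum _ fun j _ =>
    integrable_norm_gramMatrix_sub_sq i j

lemma integral_gramDeviation (hd : 0 < d) (s : Finset (Fin d)) :
    ∫ z, gramDeviation s z ∂(gaussianFamily _) = (s.card : ℝ) ^ 2 / d := by
  unfold gramDeviation
  rw [integral_finsetSum _ fun i _ => integrable_finsetSum _ fun j _ =>
    integrable_norm_gramMatrix_sub_sq i j]
  simp only [fun i => integral_finsetSum s fun j _ => integrable_norm_gramMatrix_sub_sq i j,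
    integral_norm_gramMatrix_sub_sq hd, Finset.sum_const, nsmul_eq_mul]
  ring

lemma exp_mul_gaussianTrace (p : Fin d → ℝ) (N : ℝ) (z : Fin d × Fin d → ℂ) :
    Real.exp (N * (gaussianTrace p z - 1)) =
      Real.exp (-N) * ∏ x : Fin d × Fin d, Real.exp (N * (p x.2 / d) * ‖z x‖ ^ 2) := by
  rw [← Real.exp_sum, ← Real.exp_add, gaussianTrace]
  congr 1
  rw [mul_sub, Finset.mul_sum]
  simp only [mul_assoc]
  ring

lemma inv_one_sub_le_exp {x : ℝ} (h0 : 0 ≤ x) (h1 : x ≤ 1 / 2) :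
    (1 - x)⁻¹ ≤ Real.exp (x + x ^ 2) := by
  rw [inv_le_iff_one_le_mul₀ (by linarith)]
  have h := Real.quadratic_le_exp_of_nonneg (show 0 ≤ x + x ^ 2 by positivity)
  have h2 : 1 ≤ (1 + (x + x ^ 2) + (x + x ^ 2) ^ 2 / 2) * (1 - x) := by
    have : (1 + (x + x ^ 2) + (x + x ^ 2) ^ 2 / 2) * (1 - x) - 1 =
      x ^ 2 * ((1 + x) ^ 2 * (1 - x) / 2 - x) := by ring
    have h3 : 0 ≤ (1 + x) ^ 2 * (1 - x) / 2 - x := by nlinarith [sq_nonneg x, sq_nonneg (1 - 2 * x)]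
    nlinarith [mul_nonneg (sq_nonneg x) h3]
  exact h2.trans (mul_le_mul_of_nonneg_right h (by linarith))

lemma integrable_exp_gaussianTrace {p : Fin d → ℝ} {N : ℝ} (h : ∀ r, N * (p r / d) < 1) :
    Integrable (fun z => Real.exp (N * (gaussianTrace p z - 1))) (gaussianFamily _) := by
  simp only [exp_mul_gaussianTrace]
  exact (Integrable.fintype_prod (f := fun (x : Fin d × Fin d) (w : ℂ) =>
    Real.exp (N * (p x.2 / d) * ‖w‖ ^ 2)) fun x => integrable_exp_complexGaussian (h x.2)).const_mul _

/-- Each weight `p r / d` occurs `d` times, so the linear terms from `inv_one_sub_le_exp` cancel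
`exp (-N)`, and the quadratic ones add up to at most `N ^ 2 / d`. -/
lemma integral_exp_gaussianTrace_le (hd : 0 < d) {p : Fin d → ℝ} (hp : p ∈ stdSimplex ℝ (Fin d))
    {N : ℝ} (hN : 0 ≤ N) (h : N ≤ d / 2) :
    Integrable (fun z => Real.exp (N * (gaussianTrace p z - 1))) (gaussianFamily _) ∧
    ∫ z, Real.exp (N * (gaussianTrace p z - 1)) ∂(gaussianFamily _) ≤ Real.exp (N ^ 2 / d) := by
  have hd' : (0 : ℝ) < d := by exact_mod_cast hd
  have hp1 : ∀ r, p r ≤ 1 := fun r => by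
    rw [← hp.2]; exact Finset.single_le_sum (fun i _ => hp.1 i) (Finset.mem_univ r)
  have hx0 : ∀ r, 0 ≤ N * (p r / d) := fun r => mul_nonneg hN (div_nonneg (hp.1 r) hd'.le)
  have hx1 : ∀ r, N * (p r / d) ≤ 1 / 2 := fun r => by
    rw [← mul_div_assoc, div_le_iff₀ hd']
    nlinarith [hp1 r, hp.1 r]
  have hlt : ∀ r, N * (p r / d) < 1 := fun r => (hx1 r).trans_lt (by norm_num)
  refine ⟨integrable_exp_gaussianTrace hlt, ?_⟩
  simp only [exp_mul_gaussianTrace, integral_const_mul]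
  rw [gaussianFamily, integral_fintype_prod_eq_prod (fun (x : Fin d × Fin d) (w : ℂ) =>
    Real.exp (N * (p x.2 / d) * ‖w‖ ^ 2))]
  simp only [fun x : Fin d × Fin d => integral_exp_complexGaussian (hlt x.2)]
  calc _ ≤ Real.exp (-N) * ∏ x : Fin d × Fin d,
        Real.exp (N * (p x.2 / d) + (N * (p x.2 / d)) ^ 2) := by
        refine mul_le_mul_of_nonneg_left (Finset.prod_le_prod (fun x _ => ?_) fun x _ =>
          inv_one_sub_le_exp (hx0 _) (hx1 _)) (Real.exp_pos _).le
        exact inv_nonneg.2 (by linarith [hlt x.2])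
    _ ≤ _ := by
        rw [← Real.exp_sum, ← Real.exp_add, Real.exp_le_exp, Fintype.sum_prod_type]
        simp only [Finset.sum_const, Finset.card_univ, Fintype.card_fin, nsmul_eq_mul,
          Finset.sum_add_distrib, ← Finset.mul_sum, ← Finset.sum_div, hp.2, mul_pow, div_pow]
        have hsq : ∑ r, p r ^ 2 ≤ 1 := by
          rw [← hp.2]
          exact Finset.sum_le_sum fun r _ => by nlinarith [hp.1 r, hp1 r]
        have e : -N + d * (N * (1 / d) + N ^ 2 * ((∑ r, p r ^ 2) / d ^ 2)) =
            N ^ 2 / d * ∑ r, p r ^ 2 := by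
          field_simp; ring
        rw [e]
        exact mul_le_of_le_one_right (by positivity) hsq

lemma integral_gaussianTrace (hd : 0 < d) {p : Fin d → ℝ} (hp : p ∈ stdSimplex ℝ (Fin d)) :
    Integrable (gaussianTrace p) (gaussianFamily _) ∧
    ∫ z, gaussianTrace p z ∂(gaussianFamily _) = 1 := by
  have hc : ∀ z : Fin d × Fin d → ℂ, ((gaussianTrace p z : ℝ) : ℂ) =
      ∑ x : Fin d × Fin d, ((p x.2 / d : ℝ) : ℂ) * (z x * conj (z x)) := fun z => by
    simp only [gaussianTrace, Complex.mul_conj, Complex.normSq_eq_norm_sq]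
    push_cast; rfl
  have hi : ∀ x : Fin d × Fin d, IsMixedPolynomial fun z : Fin d × Fin d → ℂ =>
      ((p x.2 / d : ℝ) : ℂ) * (z x * conj (z x)) := fun x =>
    .mul (.const _) (.mul (.var _) (.conj_var _))
  have h1 : IsMixedPolynomial fun z : Fin d × Fin d → ℂ => ((gaussianTrace p z : ℝ) : ℂ) := by
    simp only [hc]; exact .sum hi
  refine ⟨h1.integrable.re, ?_⟩
  apply Complex.ofReal_injective
  rw [← integral_complex_ofReal]
  simp only [hc]
  rw [integral_finsetSum _ fun x _ => (hi x).integrable]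
  simp only [integral_const_mul, integral_mul_conj, if_true, mul_one]
  rw [← Complex.ofReal_sum, Fintype.sum_prod_type]
  simp only [← Finset.sum_div, hp.2, Finset.sum_const, Finset.card_univ, Fintype.card_fin,
    nsmul_eq_mul]
  have hd' : (d : ℝ) ≠ 0 := by exact_mod_cast hd.ne'
  rw [mul_one, div_self hd']

/-- This is the mean of the `k`-th power of a nonnegative variable of mean `1`; Bernoulli's
inequality bounds it below. -/
lemma one_le_trace_meanTensorPower (hd : 0 < d) {p : Fin d → ℝ} (hp : p ∈ stdSimplex ℝ (Fin d))
    (k : ℕ) : 1 ≤ (meanTensorPower p k).trace.re := by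
  have h := integral_trace_mul_tensorPower p (1 : Matrix (Fin k → Fin d) (Fin k → Fin d) ℂ)
  simp only [Matrix.one_mul, trace_tensorPower, trace_gaussianState] at h
  rw [← h]
  obtain ⟨hi, h1⟩ := integral_gaussianTrace hd hp
  have hpow : Integrable (fun z => (((gaussianTrace p z : ℝ) : ℂ) ^ k).re) (gaussianFamily _) := by
    have : IsMixedPolynomial fun z : Fin d × Fin d → ℂ => ((gaussianTrace p z : ℝ) : ℂ) ^ k := by
      simp only [← trace_gaussianState, Matrix.trace, Matrix.diag_apply]
      exact .pow (.sum fun i => isMixedPolynomial_gaussianState p i i) k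
    exact this.integrable.re
  have hlin : Integrable (fun z => k * (gaussianTrace p z - 1)) (gaussianFamily _) :=
    (hi.sub (integrable_const _)).const_mul _
  calc (1 : ℝ) = ∫ z, (1 + k * (gaussianTrace p z - 1)) ∂(gaussianFamily _) := by
        rw [integral_add (integrable_const _) hlin,
          integral_const_mul, integral_sub hi (integrable_const _), h1]
        simp
    _ ≤ _ := by
        refine integral_mono ((integrable_const _).add hlin) hpow fun z => ?_
        simp only [← Complex.ofReal_pow, Complex.ofReal_re]
        have := one_add_mul_le_pow (a := gaussianTrace p z - 1)
          (by linarith [gaussianTrace_nonneg hp.1 z]) k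
        simpa using this

end Expectations

/-! ### Error budget and conclusion. -/

/-- If the protocol errs with probability at most `η` on the spectrum `p`, then the weight that
independent random states assign to the wrong answer is small. -/
theorem sum_outcomeWeight_mul_le {S : Type} [Fintype S] {d k T m : ℕ} (hd : 0 < d) (hm : 0 < m)
    (P : ReplicaProtocol S d k T) {p : Fin d → ℝ} (hp : p ∈ stdSimplex ℝ (Fin d))
    (hrank : spectrumRank p ≤ m) {g : (Fin T → S) → ℝ} (hg : ∀ x, g x ∈ Set.Icc (0 : ℝ) 1)
    (hP : ∀ ρ, IsState ρ → HasSpectrum ρ p → ∑ x, P.outcomeProb ρ x * g x ≤ 1 / 10)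
    (hn : 30 * ((k * T : ℕ) * m : ℝ) < Real.sqrt d) :
    ∑ x, P.outcomeWeight (meanTensorPower p k) x * g x ≤ 2 / 5 := by
  classical
  have hd' : (0 : ℝ) < d := by exact_mod_cast hd
  have hd1 : (1 : ℝ) ≤ d := by exact_mod_cast hd
  have hm' : (1 : ℝ) ≤ m := by exact_mod_cast hm
  set n : ℕ := k * T with hndef
  set s : Finset (Fin d) := Finset.univ.filter fun r => p r ≠ 0 with hs
  have hs0 : ∀ r, r ∉ s → p r = 0 := fun r hr => by simpa [hs] using hr
  have hscard : s.card ≤ m := by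
    refine le_trans (le_of_eq ?_) hrank
    rw [spectrumRank, ← Set.ncard_coe_finset]
    congr 1
    ext r; simp [hs]
  have hsqrt : 0 < Real.sqrt d := Real.sqrt_pos.2 hd'
  have hsq : Real.sqrt d ^ 2 = d := Real.sq_sqrt hd'.le
  have hn0 : (0 : ℝ) ≤ n := Nat.cast_nonneg n
  have hnm : (n : ℝ) ≤ n * m := le_mul_of_one_le_right hn0 hm'
  have hn1 : 30 * (n : ℝ) ≤ Real.sqrt d := by linarith
  -- Large enough that the deviation term costs at most `5/64`, small enough that `n * ε ≤ 8/30`.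
  set ε : ℝ := 8 * m / Real.sqrt d with hεdef
  have hε : 0 < ε := by positivity
  have hpow : (1 + ε) ^ n ≤ 2 := by
    have h1 : n * ε ≤ 1 / 2 := by
      rw [hεdef, mul_div_assoc', div_le_iff₀ hsqrt]; nlinarith
    calc (1 + ε) ^ n ≤ Real.exp ε ^ n :=
          pow_le_pow_left₀ (by positivity) (by linarith [Real.add_one_le_exp ε]) n
      _ = Real.exp (n * ε) := (Real.exp_nat_mul _ _).symm
      _ ≤ Real.exp (1 / 2) := Real.exp_le_exp.2 h1
      _ ≤ 1 / (1 - 1 / 2) := Real.exp_bound_div_one_sub_of_interval' (by norm_num) (by norm_num) |>.le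
      _ = 2 := by norm_num
  have hn2 : 900 * (n : ℝ) ^ 2 ≤ d := by rw [← hsq]; nlinarith
  have hsd : Real.sqrt d ≤ d := by nlinarith [Real.one_le_sqrt.2 hd1]
  obtain ⟨hiE, hE⟩ := integral_exp_gaussianTrace_le hd hp (N := (2 * n : ℕ)) (Nat.cast_nonneg _)
    (by push_cast; linarith)
  have hE2 : Real.exp (((2 * n : ℕ) : ℝ) ^ 2 / d) ≤ 2 := by
    calc _ ≤ Real.exp (1 / 2) := by
          refine Real.exp_le_exp.2 ?_
          rw [div_le_iff₀ hd']; push_cast; nlinarith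
      _ ≤ 1 / (1 - 1 / 2) := Real.exp_bound_div_one_sub_of_interval' (by norm_num) (by norm_num) |>.le
      _ = 2 := by norm_num
  have hF : 5 / ε ^ 2 * ∫ z, gramDeviation s z ∂(gaussianFamily _) ≤ 1 / 10 := by
    rw [integral_gramDeviation hd, hεdef]
    have hc : (s.card : ℝ) ≤ m := by exact_mod_cast hscard
    have hc2 : (s.card : ℝ) ^ 2 ≤ m ^ 2 := pow_le_pow_left₀ (Nat.cast_nonneg _) hc 2
    have : 5 / (8 * m / Real.sqrt d) ^ 2 * ((s.card : ℝ) ^ 2 / d) =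
        5 / 64 * ((s.card : ℝ) ^ 2 / m ^ 2) := by
      rw [div_pow, hsq, mul_pow]; field_simp; ring
    rw [this]
    have : (s.card : ℝ) ^ 2 / m ^ 2 ≤ 1 := div_le_one_of_le₀ hc2 (by positivity)
    linarith
  have hlow : ∀ x, Integrable (fun z => P.outcomeProb (gaussianState p z) x) (gaussianFamily _) ∧
      P.outcomeWeight (meanTensorPower p k) x ≤
        ∫ z, P.outcomeProb (gaussianState p z) x ∂(gaussianFamily _) := fun x =>
    prod_trace_meanTensorPower_le hp.1 _ fun t => (P.isPOVM t _).1 _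
  have hi : Integrable (fun z => ∑ x, P.outcomeProb (gaussianState p z) x * g x)
      (gaussianFamily _) := integrable_finsetSum _ fun x _ => (hlow x).1.mul_const _
  have i1 := hiE.const_mul (1 / 20)
  have i2 := (integrable_gramDeviation s).const_mul (5 / ε ^ 2)
  have i3 : Integrable (fun z => 1 / 20 * Real.exp ((2 * n : ℕ) * (gaussianTrace p z - 1)) +
      5 / ε ^ 2 * gramDeviation s z) (gaussianFamily _) := i1.add i2
  calc ∑ x, P.outcomeWeight (meanTensorPower p k) x * g x
      ≤ ∑ x, (∫ z, P.outcomeProb (gaussianState p z) x ∂(gaussianFamily _)) * g x :=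
        Finset.sum_le_sum fun x _ => mul_le_mul_of_nonneg_right (hlow x).2 (hg x).1
    _ = ∫ z, ∑ x, P.outcomeProb (gaussianState p z) x * g x ∂(gaussianFamily _) := by
        rw [integral_finsetSum _ fun x _ => (hlow x).1.mul_const _]
        simp only [integral_mul_const]
    _ ≤ ∫ z, ((1 + ε) ^ n * (1 / 10) +
        (1 / 20 * Real.exp ((2 * n : ℕ) * (gaussianTrace p z - 1)) +
          5 / ε ^ 2 * gramDeviation s z)) ∂(gaussianFamily _) :=
        integral_mono hi ((integrable_const _).add i3) fun z =>
          sum_outcomeProb_gaussianState_le P hp hs0 hg (by norm_num) hP hε z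
    -- The budget is `2 * (1/10)` from the good event, `(1/20) * 2` from the trace and `1/10` from
    -- the Gram deviation.
    _ ≤ 2 / 5 := by
        rw [integral_add (integrable_const _) i3, integral_add i1 i2, integral_const,
          integral_const_mul, integral_const_mul]
        simp only [probReal_univ, one_smul]
        linarith

/-- A spectrum of rank at most one is a point mass. -/
lemma exists_eq_single_of_spectrumRank_le_one {d : ℕ} {p : Fin d → ℝ}
    (hp : p ∈ stdSimplex ℝ (Fin d)) (h : spectrumRank p ≤ 1) : ∃ i, p = Pi.single i 1 := by
  have hne : ∃ i, p i ≠ 0 := by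
    by_contra! h0
    have := hp.2
    simp [h0] at this
  obtain ⟨i, hi⟩ := hne
  have h0 : ∀ j, j ≠ i → p j = 0 := fun j hj => by
    by_contra hpj
    exact hj ((Set.ncard_le_one (Set.toFinite _)).1 h j hpj i hi)
  refine ⟨i, funext fun j => ?_⟩
  by_cases hj : j = i
  · subst hj
    have := hp.2
    rw [Finset.sum_eq_single j (fun b _ hb => h0 b hb) (by simp)] at this
    rw [this, Pi.single_eq_same]
  · rw [h0 j hj, Pi.single_eq_of_ne hj]

/-- Both spectra are point masses, equal up to order, so a single state would require both answers.
-/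
lemma not_solvesSpectrumTesting_of_rank_le_one {S : Type} [Fintype S] {d k T : ℕ}
    (P : ReplicaProtocol S d k T) {p q : Fin d → ℝ} (hp : p ∈ stdSimplex ℝ (Fin d))
    (hq : q ∈ stdSimplex ℝ (Fin d)) (hpr : spectrumRank p ≤ 1) (hqr : spectrumRank q ≤ 1) :
    ¬ P.SolvesSpectrumTesting p q := by
  rintro ⟨h1, h2⟩
  obtain ⟨i, rfl⟩ := exists_eq_single_of_spectrumRank_le_one hp hpr
  obtain ⟨j, rfl⟩ := exists_eq_single_of_spectrumRank_le_one hq hqr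
  have hV : (1 : Matrix (Fin d) (Fin d) ℂ).conjTranspose * 1 = 1 := by simp
  have hst := isState_conj_diagonal hV hp
  have hsp := hasSpectrum_conj_diagonal hV (Pi.single i 1)
  have heq : Multiset.map (Pi.single i 1 : Fin d → ℝ) Finset.univ.val =
      Multiset.map (Pi.single j 1 : Fin d → ℝ) Finset.univ.val := by
    have e : (Pi.single i 1 : Fin d → ℝ) = (Pi.single j 1 : Fin d → ℝ) ∘ Equiv.swap i j := by
      funext r
      simp only [Function.comp_apply, Pi.single_apply]
      simp only [Equiv.swap_apply_eq_iff, Equiv.swap_apply_right]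
    rw [e, ← Multiset.map_map]
    congr 1
    exact Multiset.map_univ_val_equiv (Equiv.swap i j)
  have a1 := h1 _ hst hsp
  have a2 := h2 _ hst ⟨hsp.choose, hsp.choose_spec.trans heq⟩
  have a3 := P.probFirst_add_probSecond hst
  linarith

/-- The weights `guess` and `1 - guess` split the total mass under the common mean tensor power, and
each share is at most `2/5`. -/
theorem sqrt_le_samples_mul_rank {S : Type} [Fintype S] {d k T m : ℕ} (hd : 0 < d) (hm : 0 < m)
    (P : ReplicaProtocol S d k T) {p q : Fin d → ℝ} (hp : p ∈ stdSimplex ℝ (Fin d))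
    (hq : q ∈ stdSimplex ℝ (Fin d))
    (hpq : ∀ i ∈ Finset.Icc 1 k, ∑ r, p r ^ i = ∑ r, q r ^ i)
    (hpr : spectrumRank p ≤ m) (hqr : spectrumRank q ≤ m) (hP : P.SolvesSpectrumTesting p q) :
    Real.sqrt d ≤ 30 * ((k * T : ℕ) * m : ℝ) := by
  by_contra! hlt
  have b1 := sum_outcomeWeight_mul_le hd hm P hp hpr (g := fun x => 1 - P.guess x)
    (fun x => ⟨by linarith [(P.guess_mem x).2], by linarith [(P.guess_mem x).1]⟩)
    (fun ρ h1 h2 => by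
      have := P.probFirst_add_probSecond h1
      have h3 := hP.1 ρ h1 h2
      change P.probSecond ρ ≤ _
      linarith) hlt
  have b2 := sum_outcomeWeight_mul_le hd hm P hq hqr (g := P.guess) P.guess_mem
    (fun ρ h1 h2 => by
      have := P.probFirst_add_probSecond h1
      have h3 := hP.2 ρ h1 h2
      change P.probFirst ρ ≤ _
      linarith) hlt
  rw [← meanTensorPower_eq_of_powerSum_eq hpq] at b2
  have hsum := P.sum_outcomeWeight (meanTensorPower p k)
  have h1 := one_le_pow₀ (one_le_trace_meanTensorPower hd hp k) (n := T)
  rw [← hsum] at h1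
  have h2 : ∑ x, P.outcomeWeight (meanTensorPower p k) x =
      ∑ x, P.outcomeWeight (meanTensorPower p k) x * (1 - P.guess x) +
        ∑ x, P.outcomeWeight (meanTensorPower p k) x * P.guess x := by
    rw [← Finset.sum_add_distrib]
    exact Finset.sum_congr rfl fun x _ => by ring
  linarith

end ReplicaTesting

theorem theorem5p8 :
    ∃ c : ℝ, 0 < c ∧
      ∀ (d k m T : ℕ) (p q : Fin d → ℝ),
        0 < k →
        p ∈ stdSimplex ℝ (Fin d) → q ∈ stdSimplex ℝ (Fin d) →
        (∀ i ∈ Finset.Icc 1 k, ∑ r, p r ^ i = ∑ r, q r ^ i) →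
        ReplicaTesting.spectrumRank p ≤ m → ReplicaTesting.spectrumRank q ≤ m →
        ∀ (S : Type) [Fintype S] (P : ReplicaTesting.ReplicaProtocol S d k T),
          P.SolvesSpectrumTesting p q →
            c * Real.sqrt d ≤ (P.samples : ℝ) * (m * Real.sqrt (Real.log m)) := by
  -- The constant is `1/30` from `sqrt_le_samples_mul_rank` times the lower bound `1/2` for `√(ln
  -- m)`, valid for `m ≥ 2` since `ln 2 > 1/4`.
  refine ⟨1 / 60, by norm_num, fun d k m T p q _ hp hq hpq hpr hqr S _ P hP => ?_⟩
  have hd : 0 < d := by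
    rcases Nat.eq_zero_or_pos d with rfl | h
    · have := hp.2; simp at this
    · exact h
  have hm : 2 ≤ m := by
    by_contra! h
    exact ReplicaTesting.not_solvesSpectrumTesting_of_rank_le_one P hp hq (by omega) (by omega) hP
  have h1 := ReplicaTesting.sqrt_le_samples_mul_rank hd (by omega) P hp hq hpq hpr hqr hP
  have hlog : 1 / 2 ≤ Real.sqrt (Real.log m) := by
    refine Real.le_sqrt_of_sq_le ?_
    have h2 : Real.log 2 ≤ Real.log m :=
      Real.log_le_log (by norm_num) (by exact_mod_cast hm)
    linarith [Real.log_two_gt_d9]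
  have hnn : (0 : ℝ) ≤ (k * T : ℕ) * m := by positivity
  have h3 : (P.samples : ℝ) = (k * T : ℕ) := rfl
  rw [h3, ← mul_assoc]
  nlinarith [mul_le_mul_of_nonneg_left hlog hnn]
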